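/- **Theorem 4.5 (A Laplace Transform Identity for Subordinators).** Let $(\mathcal Z,\mathcal Y)$ be a (non-killed) two-dimensional subordinator, i.e. an $\mathbb R^2$-valued process started at $0$ with stationary independent increments whose two coordinates almost surely have right-continuous nondecreasing paths. Let $q\ge 0$, and let $e(q)$ be independent of $(\mathcal Z,\mathcal Y)$ and exponentially distributed with parameter $q$ (with $e(0)=\infty$); let $(Z,Y)$ denote $(\mathcal Z,\mathcal Y)$ killed at time $e(q)$. For those $a,b\in\mathbb R$ for which $E\,e^{-a\mathcal Z_1-b\mathcal Y_1}<\infty$ (we then say that $\kappa_{Z,Y}(a,b)$ is finite) put $$\kappa_{Z,Y}(a,b)=q-\log E\,e^{-a\mathcal Z_1-b\mathcal Y_1}.$$ For $u\ge 0$ let $T^{\mathcal Y}_u=\inf\{s\ge 0:\mathcal Y_s>u\}$, with $\inf\emptyset=+\infty$, and write $\Delta W_t=W_t-W_{t-}$. Fix real numbers $\mu,\rho,\lambda,\nu,\theta$ such that $\kappa_{Z,Y}(\theta,\mu+\lambda)$, $\kappa_{Z,Y}(\theta,\rho)$ and $\kappa_{Z,Y}(\nu,\mu)$ are finite and $\kappa_{Z,Y}(\nu,\mu)>0$.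 (i) If $\lambda\ne\rho-\mu$, then $$\int_{u\ge 0}e^{-\mu u}\,E\Big(e^{-\rho(\mathcal Y_{T^{\mathcal Y}_u}-u)-\lambda(u-\mathcal Y_{T^{\mathcal Y}_u-})-\nu \mathcal Z_{T^{\mathcal Y}_u-}-\theta\Delta\mathcal Z_{T^{\mathcal Y}_u}};\,T^{\mathcal Y}_u<e(q)\Big)\,du=\frac{\kappa_{Z,Y}(\theta,\mu+\lambda)-\kappa_{Z,Y}(\theta,\rho)}{(\mu+\lambda-\rho)\,\kappa_{Z,Y}(\nu,\mu)}.$$ (ii) If $\lambda=\rho-\mu$, then $$\int_{u\ge 0}E\Big(e^{-\rho\Delta\mathcal Y_{T^{\mathcal Y}_u}-\mu\mathcal Y_{T^{\mathcal Y}_u-}-\nu \mathcal Z_{T^{\mathcal Y}_u-}-\theta\Delta\mathcal Z_{T^{\mathcal Y}_u}};\,T^{\mathcal Y}_u<e(q)\Big)\,du=\frac{1}{\kappa_{Z,Y}(\nu,\mu)}\,\frac{\partial_+\kappa_{Z,Y}(\theta,\rho)}{\partial_+\rho},$$ provided the right derivative exists (as a finite number). In both cases the integral on the left is that of a nonnegative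 function, and its value is finite. -/

import Mathlib

open MeasureTheory ProbabilityTheory
open scoped NNReal ENNReal

namespace BivariateSubordinator

/-- `(Z, Y)` is a true (not killed) two-dimensional subordinator under `P`: a process in `ℝ²`
started at `0`, with independent and stationary increments, whose two coordinates almost surely
have right-continuous nondecreasing paths. Left limits exist automatically, by monotonicity. -/
structure IsSubordinator {Ω : Type*} [MeasurableSpace Ω] (Z Y : ℝ≥0 → Ω → ℝ)
    (P : Measure Ω) : Prop where
  measurable_fst : ∀ t, Measurable (Z t)
  measurable_snd : ∀ t, Measurable (Y t)
  start_zero : ∀ᵐ ω ∂P, Z 0 ω = 0 ∧ Y 0 ω = 0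
  indep_increments : HasIndepIncrements (fun t ω => (Z t ω, Y t ω)) P
  stationary_increments : ∀ s t : ℝ≥0,
    IdentDistrib (fun ω => (Z (s + t) ω - Z s ω, Y (s + t) ω - Y s ω))
      (fun ω => (Z t ω, Y t ω)) P P
  monotone_paths : ∀ᵐ ω ∂P, Monotone (fun t => Z t ω) ∧ Monotone (fun t => Y t ω)
  right_continuous_paths : ∀ᵐ ω ∂P, ∀ t : ℝ≥0,
    ContinuousWithinAt (fun s => Z s ω) (Set.Ici t) t ∧
      ContinuousWithinAt (fun s => Y s ω) (Set.Ici t) t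

/-- `e` is a killing time of rate `q ≥ 0` for `(Z, Y)`: it is independent of the whole process and
exponentially distributed with parameter `q`, `P (e > t) = exp (-q t)`. For `q = 0` this says that
`e = ∞` almost surely, that is, there is no killing. -/
structure IsKillingTime {Ω : Type*} [MeasurableSpace Ω] (e : Ω → ℝ≥0∞) (q : ℝ)
    (Z Y : ℝ≥0 → Ω → ℝ) (P : Measure Ω) : Prop where
  rate_nonneg : 0 ≤ q
  measurable : Measurable e
  law : ∀ t : ℝ≥0, P {ω | (t : ℝ≥0∞) < e ω} = ENNReal.ofReal (Real.exp (-(q * t)))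
  indep : IndepFun (fun ω (t : ℝ≥0) => (Z t ω, Y t ω)) e P

/-- The Laplace exponent at `(a, b)` is finite: `E exp (-a Z₁ - b Y₁) < ∞`. -/
def ExponentFinite {Ω : Type*} [MeasurableSpace Ω] (Z Y : ℝ≥0 → Ω → ℝ) (P : Measure Ω)
    (a b : ℝ) : Prop :=
  Integrable (fun ω => Real.exp (-a * Z 1 ω - b * Y 1 ω)) P

/-- The Laplace exponent `κ(a, b) = q - log E exp (-a Z₁ - b Y₁)` of the subordinator killed at
rate `q`; it is meaningful where `ExponentFinite Z Y P a b` holds. -/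
noncomputable def exponent {Ω : Type*} [MeasurableSpace Ω] (Z Y : ℝ≥0 → Ω → ℝ) (q : ℝ)
    (P : Measure Ω) (a b : ℝ) : ℝ :=
  q - Real.log (∫ ω, Real.exp (-a * Z 1 ω - b * Y 1 ω) ∂P)

/-- The first passage time `T_u = inf {s ≥ 0 : Y_s > u}`, with `inf ∅ = ∞`. -/
noncomputable def passageTime {Ω : Type*} (Y : ℝ≥0 → Ω → ℝ) (u : ℝ) (ω : Ω) : ℝ≥0∞ :=
  ⨅ (s : ℝ≥0) (_ : u < Y s ω), (s : ℝ≥0∞)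

/-- The value `W_{T_u}`, meaningful where `T_u < ∞`. -/
noncomputable def atPassage {Ω : Type*} (W Y : ℝ≥0 → Ω → ℝ) (u : ℝ) (ω : Ω) : ℝ :=
  W (passageTime Y u ω).toNNReal ω

/-- The left limit `W_{T_u-}` (with `W_{0-} = W_0`), meaningful where `T_u < ∞`. -/
noncomputable def beforePassage {Ω : Type*} (W Y : ℝ≥0 → Ω → ℝ) (u : ℝ) (ω : Ω) : ℝ :=
  Function.leftLim (fun s => W s ω) (passageTime Y u ω).toNNReal

/-- The jump `ΔW_{T_u} = W_{T_u} - W_{T_u-}`, meaningful where `T_u < ∞`. -/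
noncomputable def jumpAtPassage {Ω : Type*} (W Y : ℝ≥0 → Ω → ℝ) (u : ℝ) (ω : Ω) : ℝ :=
  atPassage W Y u ω - beforePassage W Y u ω

end BivariateSubordinator

/-!
Write `X = (Z, Y)` and `c = μ + λ`. The integrand, multiplied by `exp (-μ u)` in the first case,
is in both cases `exp (-ρ (Y_T - u) - c (u - Y_{T-}) - μ Y_{T-} - ν Z_{T-} - θ ΔZ_T)` on the event
`T = T_u < e` (`passageWeight`), so that the second case is `c = ρ`.

Along the dyadic grid of mesh `h = 2 ^ (-n)` the corresponding functional is computed exactly. The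
step of the grid which crosses the level `u` contributes `exp (-ν Z_s - μ Y_s)`, a function of the
position before the step, times a function of the increment and of `u - Y_s`; integrating over `u`
first, the independent and stationary increments turn the whole into a geometric series times the
expected crossing weight of one step (`IsSubordinator.lintegral_gridSum`), that is
`(exp (-h κ(θ, ρ)) - exp (-h κ(θ, c))) / ((c - ρ) (1 - exp (-h κ(ν, μ))))` with the exponents in
the numerator taken without killing. As `h → 0` this tends to the asserted value.

For almost every level `u` the process almost surely does not take the value `u` at a dyadic time,
and then the grid points bracketing the crossing approach `T_u` strictly from the left and weakly
from the right, so the discretised integrands converge to the integrand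
(`exists_bracket_tendsto`). Fatou's lemma gives the upper bound
(`IsSubordinator.passageFunctional_le_liminf`). For the lower bound the positions and the steps are
cut off at `Z + Y ≤ K`; the integrands are then bounded and supported on `u ≤ 2 K`, and the reverse
Fatou lemma applies (`IsSubordinator.limsup_le_passageFunctional`). What the cutoff loses is small
uniformly in the mesh: nonnegative increments whose sum is at most `K` are each at most `K`, so the
truncated Laplace transforms are submultiplicative, and a bound at a fixed time controls them at
all smaller dyadic times (`IsSubordinator.eventually_le_truncMoment_dyadic_one`,
`IsSubordinator.eventually_le_truncMoment_dyadic`). Killing is tested at the left end of the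
crossing step for the upper bound and at its right end for the lower bound, so that independence of
the killing time is needed only at deterministic times. The two sandwiching bounds also make joint
measurability of the passage functional unnecessary.

For `c = ρ` the lower bound follows from the case `c > ρ`, because the integrand decreases in `c`,
and the upper bound follows from Fatou's lemma as `c` decreases to `ρ` in the expected crossing
weight of one step (`IsSubordinator.passageFunctional_self_eq`).
-/

namespace BivariateSubordinator

open Filter Topology

section Marginals

variable {Ω : Type*} [MeasurableSpace Ω] {P : Measure Ω} {Z Y : ℝ≥0 → Ω → ℝ}

/-! ### One-dimensional marginals and the Markov property at a fixed time -/

/-- The law of `(Z_t, Y_t)` on the plane. -/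
noncomputable def marginal (Z Y : ℝ≥0 → Ω → ℝ) (P : Measure Ω) (t : ℝ≥0) : Measure (ℝ × ℝ) :=
  P.map (fun ω => (Z t ω, Y t ω))

/-- The increment of `(Z, Y)` over the interval from `s` to `t`. -/
def increment (Z Y : ℝ≥0 → Ω → ℝ) (s t : ℝ≥0) (ω : Ω) : ℝ × ℝ :=
  (Z t ω - Z s ω, Y t ω - Y s ω)

lemma IsSubordinator.measurable_pair (h : IsSubordinator Z Y P) (t : ℝ≥0) :
    Measurable (fun ω => (Z t ω, Y t ω)) :=
  (h.measurable_fst t).prodMk (h.measurable_snd t)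

lemma IsSubordinator.measurable_increment (h : IsSubordinator Z Y P) (s t : ℝ≥0) :
    Measurable (increment Z Y s t) :=
  ((h.measurable_fst t).sub (h.measurable_fst s)).prodMk
    ((h.measurable_snd t).sub (h.measurable_snd s))

lemma IsSubordinator.lintegral_marginal (h : IsSubordinator Z Y P) (t : ℝ≥0)
    {f : ℝ × ℝ → ℝ≥0∞} (hf : Measurable f) :
    ∫⁻ x, f x ∂(marginal Z Y P t) = ∫⁻ ω, f (Z t ω, Y t ω) ∂P :=
  lintegral_map hf (h.measurable_pair t)

lemma IsSubordinator.lintegral_increment (h : IsSubordinator Z Y P) (s t : ℝ≥0)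
    {f : ℝ × ℝ → ℝ≥0∞} (hf : Measurable f) :
    ∫⁻ ω, f (increment Z Y s (s + t) ω) ∂P = ∫⁻ x, f x ∂(marginal Z Y P t) := by
  rw [h.lintegral_marginal t hf]
  exact ((h.stationary_increments s t).comp hf).lintegral_eq

lemma IsSubordinator.lintegral_markov (h : IsSubordinator Z Y P) (s t : ℝ≥0)
    {f g : ℝ × ℝ → ℝ≥0∞} (hf : Measurable f) (hg : Measurable g) :
    ∫⁻ ω, f (Z s ω, Y s ω) * g (increment Z Y s (s + t) ω) ∂P
      = (∫⁻ x, f x ∂(marginal Z Y P s)) * ∫⁻ x, g x ∂(marginal Z Y P t) := by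
  have hi := h.indep_increments.indepFun_eval_sub (r := 0) (s := s) (t := s + t) (zero_le)
    (by simp) (by filter_upwards [h.start_zero] with ω hω; simp [hω.1, hω.2])
  rw [← h.lintegral_increment s t hg, h.lintegral_marginal s hf]
  exact lintegral_mul_eq_lintegral_mul_lintegral_of_indepFun
    (hf.comp (h.measurable_pair s)) (hg.comp (h.measurable_increment s (s + t)))
    (hi.comp hf hg)

/-- Independence of the killing time from the process turns killing at a fixed time `r` into the
factor `exp (-q r)`. -/
lemma IsSubordinator.lintegral_markov_killed {q : ℝ} {e : Ω → ℝ≥0∞} [IsProbabilityMeasure P]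
    (h : IsSubordinator Z Y P)
    (he : IsKillingTime e q Z Y P) (r s t : ℝ≥0)
    {f g : ℝ × ℝ → ℝ≥0∞} (hf : Measurable f) (hg : Measurable g) :
    ∫⁻ ω, (Set.Ioi (r : ℝ≥0∞)).indicator 1 (e ω) *
        (f (Z s ω, Y s ω) * g (increment Z Y s (s + t) ω)) ∂P
      = ENNReal.ofReal (Real.exp (-(q * r))) *
        ((∫⁻ x, f x ∂(marginal Z Y P s)) * ∫⁻ x, g x ∂(marginal Z Y P t)) := by
  let G : (ℝ≥0 → ℝ × ℝ) → ℝ≥0∞ := fun x => f (x s) * g (x (s + t) - x s)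
  have hG : Measurable G := by
    have h1 : Measurable fun x : ℝ≥0 → ℝ × ℝ => x s := measurable_pi_apply _
    have h2 : Measurable fun x : ℝ≥0 → ℝ × ℝ => x (s + t) := measurable_pi_apply _
    exact (hf.comp h1).mul (hg.comp (h2.sub h1))
  have hind : Measurable ((Set.Ioi (r : ℝ≥0∞)).indicator (1 : ℝ≥0∞ → ℝ≥0∞)) :=
    measurable_one.indicator measurableSet_Ioi
  have hlaw : ∫⁻ ω, (Set.Ioi (r : ℝ≥0∞)).indicator 1 (e ω) ∂P
      = ENNReal.ofReal (Real.exp (-(q * r))) := by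
    rw [← he.law r]
    have : (fun ω => (Set.Ioi (r : ℝ≥0∞)).indicator (1 : ℝ≥0∞ → ℝ≥0∞) (e ω))
        = {ω | (r : ℝ≥0∞) < e ω}.indicator 1 := by
      ext ω; simp [Set.indicator_apply]
    rw [this, lintegral_indicator_one (measurableSet_lt measurable_const he.measurable)]
  have key := lintegral_mul_eq_lintegral_mul_lintegral_of_indepFun
    (hind.comp he.measurable)
    (hG.comp (measurable_pi_lambda _ fun t => h.measurable_pair t))
    (he.indep.symm.comp hind hG)
  rw [← hlaw, ← h.lintegral_markov s t hf hg]
  exact key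

lemma IsSubordinator.ae_nonneg (h : IsSubordinator Z Y P) :
    ∀ᵐ ω ∂P, ∀ t, 0 ≤ Z t ω ∧ 0 ≤ Y t ω := by
  filter_upwards [h.start_zero, h.monotone_paths] with ω h0 hm t
  exact ⟨h0.1 ▸ hm.1 zero_le, h0.2 ▸ hm.2 zero_le⟩

lemma IsSubordinator.lintegral_marginal_add_le (h : IsSubordinator Z Y P) (s t : ℝ≥0)
    {f : ℝ × ℝ → ℝ≥0∞} (hf : Measurable f)
    (hmul : ∀ x y : ℝ × ℝ, 0 ≤ x → 0 ≤ y → f (x + y) ≤ f x * f y) :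
    ∫⁻ x, f x ∂(marginal Z Y P (s + t))
      ≤ (∫⁻ x, f x ∂(marginal Z Y P s)) * ∫⁻ x, f x ∂(marginal Z Y P t) := by
  rw [← h.lintegral_markov s t hf hf, h.lintegral_marginal _ hf]
  refine lintegral_mono_ae ?_
  filter_upwards [h.ae_nonneg, h.monotone_paths] with ω h0 hm
  have hx : ((Z (s + t) ω, Y (s + t) ω) : ℝ × ℝ)
      = (Z s ω, Y s ω) + increment Z Y s (s + t) ω := by
    simp [increment]
  rw [hx]
  refine hmul _ _ ⟨(h0 s).1, (h0 s).2⟩ ⟨?_, ?_⟩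
  · exact sub_nonneg.2 (hm.1 (by simp))
  · exact sub_nonneg.2 (hm.2 (by simp))

/-! ### Exponential moments along the dyadic times -/

/-- The exponential weight `exp (-a z - b y)`. -/
noncomputable def weight (a b : ℝ) (x : ℝ × ℝ) : ℝ≥0∞ :=
  ENNReal.ofReal (Real.exp (-a * x.1 - b * x.2))

/-- The indicator function of the half plane `z + y ≤ K`. -/
noncomputable def cutoff (K : ℝ) (x : ℝ × ℝ) : ℝ≥0∞ :=
  {x : ℝ × ℝ | x.1 + x.2 ≤ K}.indicator 1 x

@[fun_prop]
lemma measurable_weight (a b : ℝ) : Measurable (weight a b) := by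
  unfold weight; fun_prop

@[fun_prop]
lemma measurable_cutoff (K : ℝ) : Measurable (cutoff K) :=
  measurable_one.indicator (measurableSet_le (by fun_prop) (by fun_prop))

lemma cutoff_le_one (K : ℝ) (x : ℝ × ℝ) : cutoff K x ≤ 1 :=
  Set.indicator_le_self _ _ _

lemma cutoff_mono {K L : ℝ} (hKL : K ≤ L) (x : ℝ × ℝ) : cutoff K x ≤ cutoff L x := by
  by_cases hx : x.1 + x.2 ≤ K
  · simp [cutoff, hx, hx.trans hKL]
  · simp [cutoff, hx]

lemma weight_add (a b : ℝ) (x y : ℝ × ℝ) : weight a b (x + y) = weight a b x * weight a b y := by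
  unfold weight
  rw [← ENNReal.ofReal_mul (Real.exp_pos _).le, ← Real.exp_add]
  congr 2
  simp only [Prod.fst_add, Prod.snd_add]; ring

lemma cutoff_add_le (K : ℝ) {x y : ℝ × ℝ} (hx : 0 ≤ x) (hy : 0 ≤ y) :
    cutoff K (x + y) ≤ cutoff K x * cutoff K y := by
  have := hx.1; have := hx.2; have := hy.1; have := hy.2
  by_cases hK : (x + y).1 + (x + y).2 ≤ K
  · simp only [Prod.fst_add, Prod.snd_add, Prod.fst_zero, Prod.snd_zero] at *
    have h1 : x.1 + x.2 ≤ K := by linarith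
    have h2 : y.1 + y.2 ≤ K := by linarith
    simpa [cutoff, h1, h2] using cutoff_le_one K (x + y)
  · simp only [cutoff, Set.indicator_apply, Set.mem_ofPred_eq, if_neg hK]
    exact zero_le

/-- The truncated Laplace transform `E (exp (-a Z_t - b Y_t); Z_t + Y_t ≤ K)`. -/
noncomputable def truncMoment (Z Y : ℝ≥0 → Ω → ℝ) (P : Measure Ω) (a b K : ℝ) (t : ℝ≥0) : ℝ≥0∞ :=
  ∫⁻ x, weight a b x * cutoff K x ∂(marginal Z Y P t)

/-- The Laplace transform `E exp (-a Z_t - b Y_t)`, with value `∞` allowed. -/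
noncomputable def moment (Z Y : ℝ≥0 → Ω → ℝ) (P : Measure Ω) (a b : ℝ) (t : ℝ≥0) : ℝ≥0∞ :=
  ∫⁻ x, weight a b x ∂(marginal Z Y P t)

lemma truncMoment_le_moment (a b K : ℝ) (t : ℝ≥0) :
    truncMoment Z Y P a b K t ≤ moment Z Y P a b t :=
  lintegral_mono fun x => mul_le_of_le_one_right' (cutoff_le_one K x)

lemma IsSubordinator.moment_add (h : IsSubordinator Z Y P) (a b : ℝ) (s t : ℝ≥0) :
    moment Z Y P a b (s + t) = moment Z Y P a b s * moment Z Y P a b t := by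
  have hw := measurable_weight a b
  unfold moment
  rw [← h.lintegral_markov s t hw hw, h.lintegral_marginal _ hw]
  refine lintegral_congr fun ω => ?_
  rw [← weight_add]
  simp [increment]

lemma IsSubordinator.truncMoment_add_le (h : IsSubordinator Z Y P) (a b K : ℝ) (s t : ℝ≥0) :
    truncMoment Z Y P a b K (s + t) ≤ truncMoment Z Y P a b K s * truncMoment Z Y P a b K t := by
  refine h.lintegral_marginal_add_le s t (by fun_prop) fun x y hx hy => ?_
  rw [weight_add, mul_mul_mul_comm]
  gcongr
  exact cutoff_add_le K hx hy

lemma IsSubordinator.moment_zero [IsProbabilityMeasure P] (h : IsSubordinator Z Y P) (a b : ℝ) :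
    moment Z Y P a b 0 = 1 := by
  unfold moment
  rw [h.lintegral_marginal _ (measurable_weight a b)]
  have : ∀ᵐ ω ∂P, weight a b (Z 0 ω, Y 0 ω) = 1 := by
    filter_upwards [h.start_zero] with ω h0
    simp [weight, h0.1, h0.2]
  rw [lintegral_congr_ae this]; simp

lemma IsSubordinator.moment_nsmul [IsProbabilityMeasure P] (h : IsSubordinator Z Y P) (a b : ℝ)
    (t : ℝ≥0) (k : ℕ) :
    moment Z Y P a b (k * t) = moment Z Y P a b t ^ k := by
  induction k with
  | zero => simp [h.moment_zero]
  | succ k ih => rw [Nat.cast_succ, add_mul, one_mul, h.moment_add, ih, pow_succ]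

lemma IsSubordinator.truncMoment_nsmul_le (h : IsSubordinator Z Y P) (a b K : ℝ)
    (t : ℝ≥0) (k : ℕ) :
    truncMoment Z Y P a b K ((k + 1 : ℕ) * t) ≤ truncMoment Z Y P a b K t ^ (k + 1) := by
  induction k with
  | zero => simp
  | succ k ih =>
    rw [Nat.cast_succ, add_mul, one_mul, pow_succ]
    exact (h.truncMoment_add_le ..).trans (by gcongr)

/-- The dyadic time `k / 2 ^ n`. -/
noncomputable def dyadic (n k : ℕ) : ℝ≥0 := k * (2 ^ n)⁻¹

lemma dyadic_succ (n k : ℕ) : dyadic n (k + 1) = dyadic n k + dyadic n 1 := by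
  simp [dyadic, add_mul]

lemma dyadic_mono (n : ℕ) : Monotone (dyadic n) := fun k l hkl => by
  unfold dyadic; gcongr

lemma dyadic_mul_two_pow (n M : ℕ) : dyadic n (M * 2 ^ n) = M := by
  simp [dyadic]

lemma coe_dyadic (n k : ℕ) : (dyadic n k : ℝ) = k * (2 ^ n)⁻¹ := by simp [dyadic]

lemma IsSubordinator.moment_one (h : IsSubordinator Z Y P) [IsProbabilityMeasure P] {a b : ℝ}
    (hab : ExponentFinite Z Y P a b) :
    moment Z Y P a b 1 = ENNReal.ofReal (Real.exp (-exponent Z Y 0 P a b)) := by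
  have hpos : 0 < ∫ ω, Real.exp (-a * Z 1 ω - b * Y 1 ω) ∂P :=
    integral_exp_pos hab
  unfold moment exponent
  rw [h.lintegral_marginal _ (measurable_weight a b), zero_sub, neg_neg, Real.exp_log hpos,
    ofReal_integral_eq_lintegral_ofReal hab (ae_of_all _ fun _ => (Real.exp_pos _).le)]
  rfl

/-- A convolution semigroup is determined by its value at time `1`: the Laplace transform at a
dyadic time `t` is `exp (-t κ)`. -/
lemma IsSubordinator.moment_dyadic (h : IsSubordinator Z Y P) [IsProbabilityMeasure P] {a b : ℝ}
    (hab : ExponentFinite Z Y P a b) (n k : ℕ) :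
    moment Z Y P a b (dyadic n k)
      = ENNReal.ofReal (Real.exp (-(exponent Z Y 0 P a b * dyadic n k))) := by
  have h1 : moment Z Y P a b (dyadic n 1)
      = ENNReal.ofReal (Real.exp (-(exponent Z Y 0 P a b * dyadic n 1))) := by
    have h2 : moment Z Y P a b (dyadic n 1) ^ (2 ^ n) =
        ENNReal.ofReal (Real.exp (-(exponent Z Y 0 P a b * dyadic n 1))) ^ (2 ^ n) := by
      rw [← h.moment_nsmul, ← ENNReal.ofReal_pow (Real.exp_pos _).le, ← Real.exp_nat_mul]
      have : ((2 ^ n : ℕ) : ℝ≥0) * dyadic n 1 = 1 := by simp [dyadic]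
      rw [this, h.moment_one hab, coe_dyadic]
      congr 2
      push_cast
      field_simp
    exact (ENNReal.pow_right_strictMono (by positivity)).injective h2
  have h3 : dyadic n k = k * dyadic n 1 := by simp [dyadic]
  rw [h3, h.moment_nsmul, h1, ← ENNReal.ofReal_pow (Real.exp_pos _).le, ← Real.exp_nat_mul]
  congr 2
  push_cast; ring

lemma tendsto_truncMoment (a b : ℝ) (t : ℝ≥0) :
    Tendsto (fun K : ℕ => truncMoment Z Y P a b K t) atTop (𝓝 (moment Z Y P a b t)) := by
  refine lintegral_tendsto_of_tendsto_of_monotone (fun K => by fun_prop) ?_ ?_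
  · refine ae_of_all _ fun x K L hKL => ?_
    dsimp only
    gcongr
    exact cutoff_mono (by exact_mod_cast hKL) x
  · refine ae_of_all _ fun x => tendsto_const_nhds.congr' ?_
    obtain ⟨N, hN⟩ := exists_nat_ge (x.1 + x.2)
    filter_upwards [eventually_ge_atTop N] with K hK
    have : x.1 + x.2 ≤ (K : ℝ) := hN.trans (by exact_mod_cast hK)
    simp [cutoff, this]

/-- A lower bound at time `1` passes to the time `2 ^ (-n)`: nonnegative increments of total sum
at most `K` are each at most `K`, so the truncated transforms are submultiplicative. -/
lemma IsSubordinator.le_truncMoment_dyadic_one (h : IsSubordinator Z Y P) {a b K β : ℝ}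
    (hβ : ENNReal.ofReal (Real.exp (-β)) ≤ truncMoment Z Y P a b K 1) (n : ℕ) :
    ENNReal.ofReal (Real.exp (-(β * dyadic n 1))) ≤ truncMoment Z Y P a b K (dyadic n 1) := by
  have hpos : 2 ^ n ≠ 0 := by positivity
  refine (ENNReal.pow_right_strictMono hpos).le_iff_le.1 ?_
  obtain ⟨k, hk⟩ := Nat.exists_eq_succ_of_ne_zero hpos
  have h2 := h.truncMoment_nsmul_le a b K (dyadic n 1) k
  rw [← Nat.succ_eq_add_one, ← hk] at h2
  have : ((2 ^ n : ℕ) : ℝ≥0) * dyadic n 1 = 1 := by simp [dyadic]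
  rw [this] at h2
  refine le_trans (le_of_eq ?_) (hβ.trans h2)
  rw [← ENNReal.ofReal_pow (Real.exp_pos _).le, ← Real.exp_nat_mul, coe_dyadic]
  congr 2
  push_cast
  field_simp

lemma IsSubordinator.eventually_le_truncMoment_dyadic_one [IsProbabilityMeasure P]
    (h : IsSubordinator Z Y P) {a b β : ℝ}
    (hab : ExponentFinite Z Y P a b) (hβ : exponent Z Y 0 P a b < β) :
    ∀ᶠ K : ℕ in atTop, ∀ n,
      ENNReal.ofReal (Real.exp (-(β * dyadic n 1))) ≤ truncMoment Z Y P a b K (dyadic n 1) := by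
  have h1 : ENNReal.ofReal (Real.exp (-β)) < moment Z Y P a b 1 := by
    rw [h.moment_one hab]
    exact (ENNReal.ofReal_lt_ofReal_iff (Real.exp_pos _)).2 (Real.exp_lt_exp.2 (by linarith))
  filter_upwards [(tendsto_truncMoment a b 1).eventually_const_lt h1] with K hK n
  exact h.le_truncMoment_dyadic_one hK.le n

/-- For a large cutoff, the truncated transforms at all dyadic times up to `M` are at least
`exp (-η)` times the full ones: the mass lost at time `s` is dominated by the mass lost at the later
time `M`. -/
lemma IsSubordinator.eventually_le_truncMoment_dyadic [IsProbabilityMeasure P]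
    (h : IsSubordinator Z Y P) {a b η : ℝ}
    (hab : ExponentFinite Z Y P a b) (hη : 0 < η) (M : ℕ) :
    ∀ᶠ K : ℕ in atTop, ∀ n k, k ≤ M * 2 ^ n →
      ENNReal.ofReal (Real.exp (-(exponent Z Y 0 P a b * dyadic n k) - η))
        ≤ truncMoment Z Y P a b K (dyadic n k) := by
  set κ := exponent Z Y 0 P a b
  have hM : moment Z Y P a b M = ENNReal.ofReal (Real.exp (-(κ * M))) := by
    simpa [dyadic] using h.moment_dyadic hab 0 M
  have h1 : ENNReal.ofReal (Real.exp (-(κ * M) - η)) < moment Z Y P a b M := by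
    rw [hM]
    exact (ENNReal.ofReal_lt_ofReal_iff (Real.exp_pos _)).2 (Real.exp_lt_exp.2 (by linarith))
  filter_upwards [(tendsto_truncMoment a b M).eventually_const_lt h1] with K hK n k hk
  obtain ⟨j, hj⟩ := Nat.exists_eq_add_of_le hk
  have hadd : dyadic n k + dyadic n j = M := by
    rw [← dyadic_mul_two_pow n M, hj]; simp [dyadic, add_mul]
  have hadd' : (dyadic n k : ℝ) + dyadic n j = M := by exact_mod_cast congrArg NNReal.toReal hadd
  have h2 : ENNReal.ofReal (Real.exp (-(κ * M) - η)) ≤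
      truncMoment Z Y P a b K (dyadic n k) *
        ENNReal.ofReal (Real.exp (-(κ * dyadic n j))) := by
    rw [← h.moment_dyadic hab n j]
    refine hK.le.trans ?_
    rw [← hadd]
    exact (h.truncMoment_add_le ..).trans (mul_le_mul_right (truncMoment_le_moment ..) _)
  have h3 : ENNReal.ofReal (Real.exp (-(κ * M) - η)) =
      ENNReal.ofReal (Real.exp (-(κ * dyadic n k) - η)) *
        ENNReal.ofReal (Real.exp (-(κ * dyadic n j))) := by
    rw [← ENNReal.ofReal_mul (Real.exp_pos _).le, ← Real.exp_add, ← hadd']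
    congr 2; ring
  rw [h3] at h2
  exact (ENNReal.mul_le_mul_iff_left (by simp [Real.exp_pos]) ENNReal.ofReal_ne_top).1 h2

/-! ### The contribution of one time step -/

/-- The weight given to a level `v` above the current position by a step `x = (z, y)` which crosses
it, that is, `0 ≤ v < y`: the overshoot `y - v` is charged at rate `ρ`, the undershoot `v` at rate
`c`, and the simultaneous step `z` at rate `θ`. -/
noncomputable def crossing (ρ c θ v : ℝ) (x : ℝ × ℝ) : ℝ≥0∞ :=
  (Set.Ico 0 x.2).indicator
    (fun v => ENNReal.ofReal (Real.exp (-ρ * (x.2 - v) - c * v - θ * x.1))) v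

/-- The total weight `∫ exp (-ρ (y - v) - c v - θ z) dv`, `0 ≤ v < y`, of the levels crossed by a
step `(z, y)`. -/
noncomputable def crossingTotal (ρ c θ : ℝ) (x : ℝ × ℝ) : ℝ≥0∞ :=
  ∫⁻ v, crossing ρ c θ v x

@[fun_prop]
lemma measurable_crossing (ρ c θ : ℝ) :
    Measurable (fun p : ℝ × (ℝ × ℝ) => crossing ρ c θ p.1 p.2) := by
  have : (fun p : ℝ × (ℝ × ℝ) => crossing ρ c θ p.1 p.2)
      = ({p : ℝ × (ℝ × ℝ) | 0 ≤ p.1} ∩ {p | p.1 < p.2.2}).indicator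
        (fun p => ENNReal.ofReal (Real.exp (-ρ * (p.2.2 - p.1) - c * p.1 - θ * p.2.1))) := by
    ext p; simp [crossing, Set.indicator_apply]
  rw [this]
  exact Measurable.indicator (by fun_prop)
    ((measurableSet_le measurable_const _root_.measurable_fst).inter
      (measurableSet_lt measurable_fst (by fun_prop)))

@[fun_prop]
lemma measurable_crossingTotal (ρ c θ : ℝ) : Measurable (crossingTotal ρ c θ) :=
  Measurable.lintegral_prod_left' (measurable_crossing ρ c θ)

lemma crossingTotal_eq {ρ c : ℝ} (hρc : ρ ≠ c) (θ : ℝ) {x : ℝ × ℝ} (hx : 0 ≤ x.2) :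
    crossingTotal ρ c θ x = ENNReal.ofReal
      ((Real.exp (-θ * x.1 - ρ * x.2) - Real.exp (-θ * x.1 - c * x.2)) / (c - ρ)) := by
  have hne : ρ - c ≠ 0 := sub_ne_zero.2 hρc
  have hne' : c - ρ ≠ 0 := sub_ne_zero.2 hρc.symm
  unfold crossingTotal crossing
  rw [lintegral_indicator measurableSet_Ico, restrict_Ico_eq_restrict_Ioc,
    ← ofReal_integral_eq_lintegral_ofReal
      ((Continuous.integrableOn_Ioc (by fun_prop))) (ae_of_all _ fun _ => (Real.exp_pos _).le),
    ← intervalIntegral.integral_of_le hx]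
  congr 1
  have hderiv : ∀ v ∈ Set.uIcc 0 x.2, HasDerivAt
      (fun v => Real.exp (-ρ * (x.2 - v) - c * v - θ * x.1) / (ρ - c))
      (Real.exp (-ρ * (x.2 - v) - c * v - θ * x.1)) v := by
    intro v _
    have h1 : HasDerivAt (fun v => -ρ * (x.2 - v) - c * v - θ * x.1) (ρ - c) v := by
      have := ((((hasDerivAt_id v).const_sub x.2).const_mul (-ρ)).sub
        ((hasDerivAt_id v).const_mul c)).sub_const (θ * x.1)
      exact this.congr_deriv (by ring)
    have h2 := h1.exp.div_const (ρ - c)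
    rwa [mul_div_cancel_right₀ _ hne] at h2
  rw [intervalIntegral.integral_eq_sub_of_hasDerivAt hderiv
    (Continuous.intervalIntegrable (by fun_prop) _ _)]
  have e1 : -ρ * (x.2 - x.2) - c * x.2 - θ * x.1 = -θ * x.1 - c * x.2 := by ring
  have e2 : -ρ * (x.2 - 0) - c * 0 - θ * x.1 = -θ * x.1 - ρ * x.2 := by ring
  rw [e1, e2]
  field_simp
  ring

/-- The two rates enter the total crossing weight symmetrically. -/
lemma crossingTotal_comm (ρ c θ : ℝ) {x : ℝ × ℝ} (hx : 0 ≤ x.2) :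
    crossingTotal ρ c θ x = crossingTotal c ρ θ x := by
  rcases eq_or_ne ρ c with rfl | h
  · rfl
  · rw [crossingTotal_eq h θ hx, crossingTotal_eq h.symm θ hx, ← neg_div_neg_eq, neg_sub, neg_sub]

lemma crossingTotal_mul_add {ρ c : ℝ} (hρc : ρ < c) (θ : ℝ) {x : ℝ × ℝ} (hx : 0 ≤ x.2) :
    crossingTotal ρ c θ x * ENNReal.ofReal (c - ρ) + weight θ c x = weight θ ρ x := by
  have hpos : 0 < c - ρ := sub_pos.2 hρc
  have hle : Real.exp (-θ * x.1 - c * x.2) ≤ Real.exp (-θ * x.1 - ρ * x.2) :=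
    Real.exp_le_exp.2 (by nlinarith)
  rw [crossingTotal_eq hρc.ne θ hx, ← ENNReal.ofReal_mul (div_nonneg (sub_nonneg.2 hle) hpos.le),
    div_mul_cancel₀ _ hpos.ne', weight, weight,
    ← ENNReal.ofReal_add (sub_nonneg.2 hle) (Real.exp_pos _).le, sub_add_cancel]

lemma IsSubordinator.ae_marginal_nonneg (h : IsSubordinator Z Y P) (t : ℝ≥0) :
    ∀ᵐ x ∂(marginal Z Y P t), 0 ≤ x.2 := by
  refine (ae_map_iff (h.measurable_pair t).aemeasurable
    (measurableSet_le measurable_const _root_.measurable_snd)).2 ?_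
  filter_upwards [h.ae_nonneg] with ω hω using (hω t).2

lemma IsSubordinator.lintegral_crossingTotal (h : IsSubordinator Z Y P) {ρ c : ℝ} (hρc : ρ < c)
    (θ K : ℝ) (t : ℝ≥0) :
    (∫⁻ x, crossingTotal ρ c θ x * cutoff K x ∂(marginal Z Y P t)) * ENNReal.ofReal (c - ρ)
      + truncMoment Z Y P θ c K t = truncMoment Z Y P θ ρ K t := by
  unfold truncMoment
  rw [← lintegral_mul_const _ (by fun_prop), ← lintegral_add_left (by fun_prop)]
  refine lintegral_congr_ae ?_
  filter_upwards [h.ae_marginal_nonneg t] with x hx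
  rw [← crossingTotal_mul_add hρc θ hx]
  ring

lemma IsSubordinator.lintegral_crossingTotal_full (h : IsSubordinator Z Y P) {ρ c : ℝ}
    (hρc : ρ < c) (θ : ℝ) (t : ℝ≥0) :
    (∫⁻ x, crossingTotal ρ c θ x ∂(marginal Z Y P t)) * ENNReal.ofReal (c - ρ)
      + moment Z Y P θ c t = moment Z Y P θ ρ t := by
  unfold moment
  rw [← lintegral_mul_const _ (by fun_prop), ← lintegral_add_left (by fun_prop)]
  refine lintegral_congr_ae ?_
  filter_upwards [h.ae_marginal_nonneg t] with x hx
  rw [← crossingTotal_mul_add hρc θ hx]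

/-- The contribution to the discretised functional at level `u` of the step from `s` to `t`,
killed at time `r`, with weight `f` on the position and extra weight `a` on the step. -/
noncomputable def stepTerm (Z Y : ℝ≥0 → Ω → ℝ) (e : Ω → ℝ≥0∞) (ρ c θ : ℝ)
    (f a : ℝ × ℝ → ℝ≥0∞) (r s t : ℝ≥0) (u : ℝ) (ω : Ω) : ℝ≥0∞ :=
  (Set.Ioi (r : ℝ≥0∞)).indicator 1 (e ω) *
    (f (Z s ω, Y s ω) * (crossing ρ c θ (u - Y s ω) (increment Z Y s t ω)
      * a (increment Z Y s t ω)))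

lemma IsSubordinator.measurable_stepTerm (h : IsSubordinator Z Y P) {e : Ω → ℝ≥0∞}
    (he : Measurable e) (ρ c θ : ℝ)
    {f a : ℝ × ℝ → ℝ≥0∞} (hf : Measurable f) (ha : Measurable a) (r s t : ℝ≥0) :
    Measurable (fun p : ℝ × Ω => stepTerm Z Y e ρ c θ f a r s t p.1 p.2) := by
  have hind : Measurable ((Set.Ioi (r : ℝ≥0∞)).indicator (1 : ℝ≥0∞ → ℝ≥0∞)) :=
    measurable_one.indicator measurableSet_Ioi
  have h1 := h.measurable_pair s
  have h2 := h.measurable_increment s t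
  have h3 := h.measurable_snd s
  have h4 : Measurable (fun p : ℝ × Ω => crossing ρ c θ (p.1 - Y s p.2) (increment Z Y s t p.2)) :=
    (measurable_crossing ρ c θ).comp
      ((_root_.measurable_fst.sub (h3.comp _root_.measurable_snd)).prodMk
        (h2.comp _root_.measurable_snd))
  exact (hind.comp (he.comp _root_.measurable_snd)).mul
    ((hf.comp (h1.comp _root_.measurable_snd)).mul
    (h4.mul (ha.comp (h2.comp _root_.measurable_snd))))

/-- Integrating out the level first turns the crossing weight into its total, by translation
invariance; independence of the increments does the rest. -/
lemma IsSubordinator.lintegral_stepTerm [IsProbabilityMeasure P] (h : IsSubordinator Z Y P)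
    {q : ℝ} {e : Ω → ℝ≥0∞} (he : IsKillingTime e q Z Y P) (ρ c θ : ℝ)
    {f a : ℝ × ℝ → ℝ≥0∞} (hf : Measurable f) (ha : Measurable a) (r s t : ℝ≥0) :
    ∫⁻ u in Set.Ici (0 : ℝ), ∫⁻ ω, stepTerm Z Y e ρ c θ f a r s (s + t) u ω ∂P
      = ENNReal.ofReal (Real.exp (-(q * r))) *
        ((∫⁻ x, f x ∂(marginal Z Y P s)) *
          ∫⁻ x, crossingTotal ρ c θ x * a x ∂(marginal Z Y P t)) := by
  have hm := h.measurable_stepTerm he.measurable ρ c θ hf ha r s (s + t)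
  rw [lintegral_lintegral_swap hm.aemeasurable,
    ← h.lintegral_markov_killed he r s t hf (by fun_prop)]
  refine lintegral_congr_ae ?_
  filter_upwards [h.ae_nonneg] with ω hω
  have hsub : ∫⁻ u in Set.Ici (0 : ℝ), crossing ρ c θ (u - Y s ω) (increment Z Y s (s + t) ω)
      = crossingTotal ρ c θ (increment Z Y s (s + t) ω) := by
    rw [crossingTotal, ← lintegral_sub_right_eq_self (fun v => crossing ρ c θ v _) (Y s ω)]
    refine setLIntegral_eq_of_support_subset fun u hu => ?_
    have h1 : u - Y s ω ∈ Set.Ico 0 (increment Z Y s (s + t) ω).2 :=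
      Set.mem_of_indicator_ne_zero hu
    have := h1.1
    have := (hω s).2
    exact Set.mem_Ici.2 (by linarith)
  have hc : Measurable fun u => crossing ρ c θ (u - Y s ω) (increment Z Y s (s + t) ω) :=
    (measurable_crossing ρ c θ).comp ((measurable_id.sub_const _).prodMk measurable_const)
  simp only [stepTerm]
  rw [lintegral_const_mul _ (by fun_prop), lintegral_const_mul _ (by fun_prop),
    lintegral_mul_const _ hc, hsub]

/-! ### The discretised functional -/

/-- The functional of the passage over `u` computed along the grid of mesh `2 ^ (-n)`; killing acts
at the beginning (`d = 0`) or at the end (`d = 1`) of the step that crosses `u`. -/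
noncomputable def gridSum (Z Y : ℝ≥0 → Ω → ℝ) (e : Ω → ℝ≥0∞) (ρ c θ : ℝ)
    (f a : ℝ × ℝ → ℝ≥0∞) (d n : ℕ) (u : ℝ) (ω : Ω) : ℝ≥0∞ :=
  ∑' k, stepTerm Z Y e ρ c θ f a (dyadic n (k + d)) (dyadic n k) (dyadic n (k + 1)) u ω

lemma IsSubordinator.measurable_gridSum (h : IsSubordinator Z Y P) {e : Ω → ℝ≥0∞}
    (he : Measurable e) (ρ c θ : ℝ)
    {f a : ℝ × ℝ → ℝ≥0∞} (hf : Measurable f) (ha : Measurable a) (d n : ℕ) :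
    Measurable (fun p : ℝ × Ω => gridSum Z Y e ρ c θ f a d n p.1 p.2) :=
  Measurable.tsum fun _ => h.measurable_stepTerm he ρ c θ hf ha _ _ _

lemma IsSubordinator.lintegral_gridSum [IsProbabilityMeasure P] (h : IsSubordinator Z Y P)
    {q : ℝ} {e : Ω → ℝ≥0∞} (he : IsKillingTime e q Z Y P) (ρ c θ : ℝ)
    {f a : ℝ × ℝ → ℝ≥0∞} (hf : Measurable f) (ha : Measurable a) (d n : ℕ) :
    ∫⁻ u in Set.Ici (0 : ℝ), ∫⁻ ω, gridSum Z Y e ρ c θ f a d n u ω ∂P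
      = (∑' k, ENNReal.ofReal (Real.exp (-(q * dyadic n (k + d)))) *
          ∫⁻ x, f x ∂(marginal Z Y P (dyadic n k))) *
          ∫⁻ x, crossingTotal ρ c θ x * a x ∂(marginal Z Y P (dyadic n 1)) := by
  have hm := fun r s t => h.measurable_stepTerm he.measurable ρ c θ hf ha r s t
  unfold gridSum
  have hm' := fun u k => ((hm (dyadic n (k + d)) (dyadic n k) (dyadic n (k + 1))).comp
    (measurable_prodMk_left (x := u))).aemeasurable (μ := P)
  simp only [Function.comp_def] at hm'
  simp_rw [fun u => lintegral_tsum (hm' u)]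
  rw [lintegral_tsum fun k => (hm _ _ _).lintegral_prod_right'.aemeasurable,
    ← ENNReal.tsum_mul_right]
  refine tsum_congr fun k => ?_
  rw [dyadic_succ, h.lintegral_stepTerm he ρ c θ hf ha, mul_assoc]

end Marginals

/-! ### Dyadic approximation of the passage along a fixed path -/

section Pathwise

variable {Ω : Type*} {Z Y : ℝ≥0 → Ω → ℝ} {u : ℝ} {ω : Ω}

/-- At a level crossed by the step number `k`, the sum over the steps reduces to one term. -/
lemma gridSum_eq_stepTerm {e : Ω → ℝ≥0∞} (ρ c θ : ℝ) (f a : ℝ × ℝ → ℝ≥0∞) (d n : ℕ)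
    (hm : Monotone fun t => Y t ω) {k : ℕ} (hk : Y (dyadic n k) ω ≤ u)
    (hk' : u < Y (dyadic n (k + 1)) ω) :
    gridSum Z Y e ρ c θ f a d n u ω =
      stepTerm Z Y e ρ c θ f a (dyadic n (k + d)) (dyadic n k) (dyadic n (k + 1)) u ω := by
  refine tsum_eq_single k fun j hj => ?_
  have hnot : u - Y (dyadic n j) ω ∉
      Set.Ico 0 (increment Z Y (dyadic n j) (dyadic n (j + 1)) ω).2 := by
    rintro ⟨h1, h2⟩
    simp only [increment] at h2
    rcases lt_or_gt_of_ne hj with hlt | hlt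
    · have : Y (dyadic n (j + 1)) ω ≤ Y (dyadic n k) ω := hm (dyadic_mono n hlt)
      linarith
    · have : Y (dyadic n (k + 1)) ω ≤ Y (dyadic n j) ω := hm (dyadic_mono n hlt)
      linarith
  simp [stepTerm, crossing, Set.indicator_of_notMem hnot]

/-- A level that is never crossed contributes nothing. -/
lemma gridSum_eq_zero {e : Ω → ℝ≥0∞} (ρ c θ : ℝ) (f a : ℝ × ℝ → ℝ≥0∞) (d n : ℕ)
    (hu : ∀ t, Y t ω ≤ u) :
    gridSum Z Y e ρ c θ f a d n u ω = 0 := by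
  refine ENNReal.tsum_eq_zero.2 fun j => ?_
  have hnot : u - Y (dyadic n j) ω ∉
      Set.Ico 0 (increment Z Y (dyadic n j) (dyadic n (j + 1)) ω).2 := by
    rintro ⟨h1, h2⟩
    simp only [increment] at h2
    linarith [hu (dyadic n (j + 1))]
  simp [stepTerm, crossing, Set.indicator_of_notMem hnot]

lemma passageTime_le {s : ℝ≥0} (hs : u < Y s ω) : passageTime Y u ω ≤ s :=
  iInf₂_le s hs

lemma le_passageTime (hm : Monotone fun t => Y t ω) {s : ℝ≥0} (hs : Y s ω ≤ u) :
    (s : ℝ≥0∞) ≤ passageTime Y u ω := by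
  refine le_iInf₂ fun t ht => ENNReal.coe_le_coe.2 ?_
  by_contra! hlt
  exact absurd (hm hlt.le) (not_le.2 (hs.trans_lt ht))

lemma lt_passageTime (hm : Monotone fun t => Y t ω) {s : ℝ≥0} (hs : Y s ω < u)
    (hc : ContinuousWithinAt (fun t => Y t ω) (Set.Ici s) s) :
    (s : ℝ≥0∞) < passageTime Y u ω := by
  have h1 : ∀ᶠ t in 𝓝[>] s, Y t ω < u :=
    (hc.mono_left (nhdsWithin_mono _ Set.Ioi_subset_Ici_self)).eventually_lt_const hs
  obtain ⟨t, ht, hst⟩ := (h1.and self_mem_nhdsWithin).exists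
  exact (ENNReal.coe_lt_coe.2 hst).trans_le (le_passageTime hm ht.le)

lemma exists_dyadic_bracket (hm : Monotone fun t => Y t ω) (h0 : Y 0 ω ≤ u)
    (hfin : ∃ s, u < Y s ω) (n : ℕ) :
    ∃ k, Y (dyadic n k) ω ≤ u ∧ u < Y (dyadic n (k + 1)) ω := by
  classical
  have hex : ∃ k, u < Y (dyadic n k) ω := by
    obtain ⟨s, hs⟩ := hfin
    obtain ⟨M, hM⟩ := exists_nat_ge s
    exact ⟨M * 2 ^ n, hs.trans_le (hm ((dyadic_mul_two_pow n M).symm ▸ hM))⟩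
  have hne : Nat.find hex ≠ 0 := fun h => by
    have := Nat.find_spec hex
    rw [h] at this
    simp only [dyadic, Nat.cast_zero, zero_mul] at this
    exact absurd this (not_lt.2 h0)
  obtain ⟨k, hk⟩ := Nat.exists_eq_succ_of_ne_zero hne
  refine ⟨k, not_lt.1 (Nat.find_min hex (by omega)), ?_⟩
  have := Nat.find_spec hex
  rwa [hk] at this

lemma tendsto_dyadic_one : Tendsto (fun n => dyadic n 1) atTop (𝓝 0) := by
  have : (fun n => dyadic n 1) = fun n => (2⁻¹ : ℝ≥0) ^ n := by
    ext n; simp [dyadic]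
  rw [this]
  refine NNReal.tendsto_pow_atTop_nhds_zero_of_lt_one (inv_lt_one_of_one_lt₀ one_lt_two)

/-- If `Y` does not take the value `u` at a dyadic time, the grid points that bracket the crossing
of `u` approach the passage time strictly from the left, respectively from the right, so that the
values of the path there tend to its left limit and its value at the passage time. -/
lemma exists_bracket_tendsto (hmZ : Monotone fun t => Z t ω) (hmY : Monotone fun t => Y t ω)
    (hc : ∀ t : ℝ≥0, ContinuousWithinAt (fun s => Z s ω) (Set.Ici t) t ∧
      ContinuousWithinAt (fun s => Y s ω) (Set.Ici t) t)
    (h0 : Y 0 ω ≤ u) (hfin : ∃ s, u < Y s ω) (hu : ∀ n k, Y (dyadic n k) ω ≠ u) :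
    ∃ k : ℕ → ℕ, (∀ n, Y (dyadic n (k n)) ω ≤ u ∧ u < Y (dyadic n (k n + 1)) ω ∧
        (dyadic n (k n) : ℝ≥0∞) ≤ passageTime Y u ω ∧
        passageTime Y u ω ≤ dyadic n (k n + 1)) ∧
      Tendsto (fun n => Z (dyadic n (k n)) ω) atTop (𝓝 (beforePassage Z Y u ω)) ∧
      Tendsto (fun n => Y (dyadic n (k n)) ω) atTop (𝓝 (beforePassage Y Y u ω)) ∧
      Tendsto (fun n => Z (dyadic n (k n + 1)) ω) atTop (𝓝 (atPassage Z Y u ω)) ∧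
      Tendsto (fun n => Y (dyadic n (k n + 1)) ω) atTop (𝓝 (atPassage Y Y u ω)) := by
  choose k hk hk' using exists_dyadic_bracket hmY h0 hfin
  have hlt : ∀ n, (dyadic n (k n) : ℝ≥0∞) < passageTime Y u ω := fun n =>
    lt_passageTime hmY (lt_of_le_of_ne (hk n) (hu n (k n))) (hc _).2
  have hge : ∀ n, passageTime Y u ω ≤ dyadic n (k n + 1) := fun n => passageTime_le (hk' n)
  obtain ⟨τ, hτ⟩ : ∃ τ : ℝ≥0, passageTime Y u ω = τ :=
    ⟨_, (ENNReal.coe_toNNReal (ne_top_of_le_ne_top ENNReal.coe_ne_top (hge 0))).symm⟩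
  have hlt' : ∀ n, dyadic n (k n) < τ := fun n => by
    have := hlt n; rw [hτ] at this; exact_mod_cast this
  have hge' : ∀ n, τ ≤ dyadic n (k n + 1) := fun n => by
    have := hge n; rw [hτ] at this; exact_mod_cast this
  have hl : Tendsto (fun n => dyadic n (k n)) atTop (𝓝 τ) := by
    have h1 : Tendsto (fun n => τ - dyadic n 1) atTop (𝓝 τ) := by
      simpa using tendsto_dyadic_one.const_sub τ
    refine tendsto_of_tendsto_of_tendsto_of_le_of_le h1 tendsto_const_nhds (fun n => ?_)
      fun n => (hlt' n).le
    exact tsub_le_iff_right.2 (dyadic_succ n (k n) ▸ hge' n)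
  have hr : Tendsto (fun n => dyadic n (k n + 1)) atTop (𝓝 τ) := by
    simp_rw [dyadic_succ _ (k _)]
    simpa using hl.add tendsto_dyadic_one
  have hl' : Tendsto (fun n => dyadic n (k n)) atTop (𝓝[<] τ) :=
    tendsto_nhdsWithin_iff.2 ⟨hl, Eventually.of_forall hlt'⟩
  have hr' : Tendsto (fun n => dyadic n (k n + 1)) atTop (𝓝[≥] τ) :=
    tendsto_nhdsWithin_iff.2 ⟨hr, Eventually.of_forall hge'⟩
  refine ⟨k, fun n => ⟨hk n, hk' n, (hlt n).le, hge n⟩, ?_, ?_, ?_, ?_⟩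
  · simp only [beforePassage, hτ, ENNReal.toNNReal_coe]
    exact (hmZ.tendsto_leftLim τ).comp hl'
  · simp only [beforePassage, hτ, ENNReal.toNNReal_coe]
    exact (hmY.tendsto_leftLim τ).comp hl'
  · simp only [atPassage, hτ, ENNReal.toNNReal_coe]
    exact (hc τ).1.tendsto.comp hr'
  · simp only [atPassage, hτ, ENNReal.toNNReal_coe]
    exact (hc τ).2.tendsto.comp hr'

/-- The integrand of the passage functional at level `u`, before killing: with `c = μ + λ`, it is
`exp (-μ u)` times the integrand of the Laplace transform identity. -/
noncomputable def passageWeight (Z Y : ℝ≥0 → Ω → ℝ) (μ ρ c ν θ : ℝ) (u : ℝ) (ω : Ω) : ℝ≥0∞ :=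
  ENNReal.ofReal (Real.exp (-ρ * (atPassage Y Y u ω - u) - c * (u - beforePassage Y Y u ω)
    - μ * beforePassage Y Y u ω - ν * beforePassage Z Y u ω - θ * jumpAtPassage Z Y u ω))

/-- The discretised passage weight of a step from `s` to `t` which crosses `u`: the left limits at
the passage time are replaced by values at `s`, and the values at the passage time by those
at `t`. -/
noncomputable def stepWeight (Z Y : ℝ≥0 → Ω → ℝ) (μ ρ c ν θ : ℝ) (s t : ℝ≥0) (u : ℝ) (ω : Ω) :
    ℝ≥0∞ :=
  ENNReal.ofReal (Real.exp (-ρ * (Y t ω - u) - c * (u - Y s ω)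
    - μ * Y s ω - ν * Z s ω - θ * (Z t ω - Z s ω)))

lemma stepTerm_eq (e : Ω → ℝ≥0∞) (μ ρ c ν θ : ℝ) (a : ℝ × ℝ → ℝ≥0∞) (r s t : ℝ≥0)
    (hs : Y s ω ≤ u) (ht : u < Y t ω) :
    stepTerm Z Y e ρ c θ (fun x => weight ν μ x * a x) a r s t u ω
      = (Set.Ioi (r : ℝ≥0∞)).indicator 1 (e ω) *
        (a (Z s ω, Y s ω) * a (increment Z Y s t ω) * stepWeight Z Y μ ρ c ν θ s t u ω) := by
  have hmem : u - Y s ω ∈ Set.Ico 0 (increment Z Y s t ω).2 :=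
    ⟨sub_nonneg.2 hs, by simp only [increment]; linarith⟩
  have hw : weight ν μ (Z s ω, Y s ω) * crossing ρ c θ (u - Y s ω) (increment Z Y s t ω)
      = stepWeight Z Y μ ρ c ν θ s t u ω := by
    unfold crossing weight stepWeight
    rw [Set.indicator_of_mem hmem, ← ENNReal.ofReal_mul (Real.exp_pos _).le, ← Real.exp_add]
    congr 2
    simp only [increment]; ring
  unfold stepTerm
  rw [← hw]
  ring

lemma exists_tendsto_stepWeight (hmZ : Monotone fun t => Z t ω) (hmY : Monotone fun t => Y t ω)
    (hc : ∀ t : ℝ≥0, ContinuousWithinAt (fun s => Z s ω) (Set.Ici t) t ∧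
      ContinuousWithinAt (fun s => Y s ω) (Set.Ici t) t)
    (h0 : Y 0 ω ≤ u) (hfin : ∃ s, u < Y s ω) (hu : ∀ n k, Y (dyadic n k) ω ≠ u)
    (μ ρ c ν θ : ℝ) :
    ∃ k : ℕ → ℕ, (∀ n, Y (dyadic n (k n)) ω ≤ u ∧ u < Y (dyadic n (k n + 1)) ω ∧
        (dyadic n (k n) : ℝ≥0∞) ≤ passageTime Y u ω ∧
        passageTime Y u ω ≤ dyadic n (k n + 1)) ∧
      Tendsto (fun n => stepWeight Z Y μ ρ c ν θ (dyadic n (k n)) (dyadic n (k n + 1)) u ω) atTop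
        (𝓝 (passageWeight Z Y μ ρ c ν θ u ω)) := by
  obtain ⟨k, hk, h1, h2, h3, h4⟩ := exists_bracket_tendsto hmZ hmY hc h0 hfin hu
  refine ⟨k, hk, ?_⟩
  refine (ENNReal.continuous_ofReal.tendsto _).comp ((Real.continuous_exp.tendsto _).comp ?_)
  exact (((((h4.sub_const u).const_mul (-ρ)).sub ((h2.const_sub u).const_mul c)).sub
    (h2.const_mul μ)).sub (h1.const_mul ν)).sub ((h3.sub h1).const_mul θ)

/-- Killing tested at the left end of the crossing step, which precedes the passage time. -/
lemma passageWeight_le_liminf (e : Ω → ℝ≥0∞) (hmZ : Monotone fun t => Z t ω)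
    (hmY : Monotone fun t => Y t ω)
    (hc : ∀ t : ℝ≥0, ContinuousWithinAt (fun s => Z s ω) (Set.Ici t) t ∧
      ContinuousWithinAt (fun s => Y s ω) (Set.Ici t) t)
    (h0 : Y 0 ω ≤ u) (hu : ∀ n k, Y (dyadic n k) ω ≠ u) (μ ρ c ν θ : ℝ) :
    {ω | passageTime Y u ω < e ω}.indicator (passageWeight Z Y μ ρ c ν θ u) ω ≤
      liminf (fun n => gridSum Z Y e ρ c θ (fun x => weight ν μ x * 1) (fun _ => 1) 0 n u ω)
        atTop := by
  by_cases hT : passageTime Y u ω < e ω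
  · have hfin : ∃ s, u < Y s ω := by
      by_contra! hcon
      have : passageTime Y u ω = ⊤ := by simp [passageTime, fun s => not_lt.2 (hcon s)]
      exact not_top_lt (this ▸ hT)
    obtain ⟨k, hk, hlim⟩ := exists_tendsto_stepWeight hmZ hmY hc h0 hfin hu μ ρ c ν θ
    rw [Set.indicator_of_mem (by exact hT), ← hlim.liminf_eq]
    refine le_of_eq (congrArg (fun v => liminf v atTop) (funext fun n => ?_))
    obtain ⟨hk1, hk2, hk3, hk4⟩ := hk n
    have hmem : e ω ∈ Set.Ioi (dyadic n (k n + 0) : ℝ≥0∞) := hk3.trans_lt hT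
    rw [gridSum_eq_stepTerm _ _ _ _ _ _ _ hmY hk1 hk2,
      stepTerm_eq e μ ρ c ν θ (fun _ => 1) _ _ _ hk1 hk2, Set.indicator_of_mem hmem]
    simp
  · rw [Set.indicator_of_notMem (by exact hT)]
    exact zero_le

/-- Killing tested at the right end of the crossing step, which the passage time precedes. -/
lemma limsup_le_passageWeight (e : Ω → ℝ≥0∞) (hmZ : Monotone fun t => Z t ω)
    (hmY : Monotone fun t => Y t ω)
    (hc : ∀ t : ℝ≥0, ContinuousWithinAt (fun s => Z s ω) (Set.Ici t) t ∧
      ContinuousWithinAt (fun s => Y s ω) (Set.Ici t) t)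
    (h0 : Y 0 ω ≤ u) (hu : ∀ n k, Y (dyadic n k) ω ≠ u) (μ ρ c ν θ K : ℝ) :
    limsup (fun n => gridSum Z Y e ρ c θ (fun x => weight ν μ x * cutoff K x) (cutoff K) 1 n u ω)
        atTop ≤
      {ω | passageTime Y u ω < e ω}.indicator (passageWeight Z Y μ ρ c ν θ u) ω := by
  by_cases hfin : ∃ s, u < Y s ω
  · obtain ⟨k, hk, hlim⟩ := exists_tendsto_stepWeight hmZ hmY hc h0 hfin hu μ ρ c ν θ
    have hgrid := fun n => (gridSum_eq_stepTerm (Z := Z) (e := e) ρ c θ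
        (fun x => weight ν μ x * cutoff K x) (cutoff K) 1 n hmY (hk n).1 (hk n).2.1).trans
      (stepTerm_eq e μ ρ c ν θ (cutoff K) _ _ _ (hk n).1 (hk n).2.1)
    by_cases hT : passageTime Y u ω < e ω
    · rw [Set.indicator_of_mem (by exact hT), ← hlim.limsup_eq]
      refine limsup_le_limsup (Eventually.of_forall fun n => ?_)
      dsimp only
      rw [hgrid]
      refine mul_le_of_le_one_of_le (Set.indicator_le_self _ _ _) ?_
      exact mul_le_of_le_one_left' (mul_le_one' (cutoff_le_one _ _) (cutoff_le_one _ _))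
    · have hzero : ∀ n, gridSum Z Y e ρ c θ (fun x => weight ν μ x * cutoff K x) (cutoff K) 1 n u ω
          = 0 := fun n => by
        rw [hgrid, Set.indicator_of_notMem, zero_mul]
        exact fun hmem => hT ((hk n).2.2.2.trans_lt hmem)
      simp [hzero]
  · push Not at hfin
    simp [gridSum_eq_zero ρ c θ _ _ 1 _ hfin]

/-- With a cutoff, the discretised functionals are bounded and vanish at high levels. -/
lemma gridSum_cutoff_le (e : Ω → ℝ≥0∞) (hmZ : Monotone fun t => Z t ω)
    (hmY : Monotone fun t => Y t ω) (h0Z : 0 ≤ Z 0 ω) (h0Y : 0 ≤ Y 0 ω) (hu0 : Y 0 ω ≤ u)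
    (μ ρ c ν θ K : ℝ) (n : ℕ) :
    gridSum Z Y e ρ c θ (fun x => weight ν μ x * cutoff K x) (cutoff K) 1 n u ω ≤
      (Set.Icc 0 (2 * K)).indicator (fun _ => ENNReal.ofReal
        (Real.exp ((|ρ| + |c| + |μ| + |ν| + |θ|) * (2 * K)))) u := by
  by_cases hfin : ∃ s, u < Y s ω
  · obtain ⟨k, hk1, hk2⟩ := exists_dyadic_bracket hmY hu0 hfin n
    rw [gridSum_eq_stepTerm _ _ _ _ _ _ _ hmY hk1 hk2, stepTerm_eq e μ ρ c ν θ _ _ _ _ hk1 hk2]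
    set s := dyadic n k
    set t := dyadic n (k + 1)
    by_cases hs : Z s ω + Y s ω ≤ K
    swap
    · simp [cutoff, hs]
    by_cases hi : (increment Z Y s t ω).1 + (increment Z Y s t ω).2 ≤ K
    swap
    · simp [cutoff, hi]
    have hi' : (Z t ω - Z s ω) + (Y t ω - Y s ω) ≤ K := hi
    have hst : s ≤ t := dyadic_mono n (Nat.le_succ k)
    have hZ0 : 0 ≤ Z s ω := h0Z.trans (hmZ zero_le)
    have hY0 : 0 ≤ Y s ω := h0Y.trans (hmY zero_le)
    have hZt : Z s ω ≤ Z t ω := hmZ hst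
    have hYt : Y s ω ≤ Y t ω := hmY hst
    rw [Set.indicator_of_mem (s := Set.Icc 0 (2 * K)) ⟨h0Y.trans hu0, by linarith⟩]
    refine mul_le_of_le_one_of_le (Set.indicator_le_self _ _ _) ?_
    refine (mul_le_of_le_one_left' (mul_le_one' (cutoff_le_one _ _) (cutoff_le_one _ _))).trans ?_
    refine ENNReal.ofReal_le_ofReal (Real.exp_le_exp.2 ?_)
    have key : ∀ b x : ℝ, 0 ≤ x → x ≤ 2 * K → -(b * x) ≤ |b| * (2 * K) := fun b x hx hx' =>
      calc -(b * x) ≤ |b * x| := neg_le_abs _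
        _ = |b| * x := by rw [abs_mul, abs_of_nonneg hx]
        _ ≤ |b| * (2 * K) := by gcongr
    have h1 := key ρ (Y t ω - u) (by linarith) (by linarith)
    have h2 := key c (u - Y s ω) (by linarith) (by linarith)
    have h3 := key μ (Y s ω) hY0 (by linarith)
    have h4 := key ν (Z s ω) hZ0 (by linarith)
    have h5 := key θ (Z t ω - Z s ω) (by linarith) (by linarith)
    linarith
  · push Not at hfin
    rw [gridSum_eq_zero _ _ _ _ _ _ _ hfin]
    exact zero_le

end Pathwise

section Functional

variable {Ω : Type*} [MeasurableSpace Ω] {P : Measure Ω} {Z Y : ℝ≥0 → Ω → ℝ}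

/-! ### Comparison of the passage functional with its discretisations -/

/-- The double integral of the passage weight over the levels `u ≥ 0` and the event that passage
happens before killing. -/
noncomputable def passageFunctional (Z Y : ℝ≥0 → Ω → ℝ) (e : Ω → ℝ≥0∞) (P : Measure Ω)
    (μ ρ c ν θ : ℝ) : ℝ≥0∞ :=
  ∫⁻ u in Set.Ici (0 : ℝ), ∫⁻ ω in {ω | passageTime Y u ω < e ω},
    passageWeight Z Y μ ρ c ν θ u ω ∂P

/-- The event of passage before killing agrees almost surely with a countable union over rational
times, so the integral over it is the integral of an indicator function. -/
lemma IsSubordinator.nullMeasurableSet_passage (h : IsSubordinator Z Y P) {e : Ω → ℝ≥0∞}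
    (he : Measurable e) (u : ℝ) :
    NullMeasurableSet {ω | passageTime Y u ω < e ω} P := by
  have hmeas : MeasurableSet (⋃ r : ℚ, {ω | u < Y (r : ℝ).toNNReal ω} ∩
      {ω | ((r : ℝ).toNNReal : ℝ≥0∞) < e ω}) :=
    MeasurableSet.iUnion fun r => (measurableSet_lt measurable_const (h.measurable_snd _)).inter
      (measurableSet_lt measurable_const he)
  refine hmeas.nullMeasurableSet.congr ?_
  filter_upwards [h.monotone_paths] with ω hω
  refine propext ⟨fun hmem => ?_, fun hmem => ?_⟩
  · obtain ⟨r, hr, hr'⟩ := Set.mem_iUnion.1 hmem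
    exact (passageTime_le hr).trans_lt hr'
  · have hlt : passageTime Y u ω < e ω := hmem
    obtain ⟨s, hs⟩ := iInf_lt_iff.1 hlt
    obtain ⟨hsu, hse⟩ := iInf_lt_iff.1 hs
    obtain ⟨r, -, h1, h2⟩ := ENNReal.lt_iff_exists_rat_btwn.1 hse
    refine Set.mem_iUnion.2 ⟨r, ?_, h2⟩
    exact lt_of_lt_of_le hsu (hω.2 (ENNReal.coe_le_coe.1 h1.le))

/-- The laws of the countably many variables `Y_t`, `t` dyadic, have countably many atoms in all. -/
lemma IsSubordinator.ae_forall_dyadic_ne [IsProbabilityMeasure P] (h : IsSubordinator Z Y P) :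
    ∀ᵐ u : ℝ, ∀ᵐ ω ∂P, ∀ n k, Y (dyadic n k) ω ≠ u := by
  have key : ∀ n k, ∀ᵐ u : ℝ, ∀ᵐ ω ∂P, Y (dyadic n k) ω ≠ u := fun n k => by
    have hc := Measure.countable_meas_level_set_pos (μ := P) (h.measurable_snd (dyadic n k))
    filter_upwards [hc.ae_notMem volume] with u hu
    simpa [ae_iff] using hu
  filter_upwards [ae_all_iff.2 fun n => ae_all_iff.2 (key n)] with u hu
  exact ae_all_iff.2 fun n => ae_all_iff.2 (hu n)

lemma IsSubordinator.passageFunctional_le_liminf [IsProbabilityMeasure P]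
    (h : IsSubordinator Z Y P) {q : ℝ} {e : Ω → ℝ≥0∞} (he : IsKillingTime e q Z Y P)
    (μ ρ c ν θ : ℝ) :
    passageFunctional Z Y e P μ ρ c ν θ ≤ liminf (fun n =>
      (∑' k, ENNReal.ofReal (Real.exp (-(q * dyadic n k))) * moment Z Y P ν μ (dyadic n k)) *
        ∫⁻ x, crossingTotal ρ c θ x ∂(marginal Z Y P (dyadic n 1))) atTop := by
  -- `weight * 1` is the form of the position weight shared with the truncated functional
  have hm := fun n => h.measurable_gridSum he.measurable ρ c θ
    (f := fun x => weight ν μ x * 1) (a := fun _ => 1) (by fun_prop) (by fun_prop) 0 n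
  have hint := fun n => h.lintegral_gridSum he ρ c θ
    (f := fun x => weight ν μ x * 1) (a := fun _ => 1) (by fun_prop) (by fun_prop) 0 n
  simp only [mul_one, add_zero] at hint hm
  simp_rw [moment, ← hint]
  refine le_trans ?_ (lintegral_liminf_le fun n => (hm n).lintegral_prod_right')
  refine lintegral_mono_ae ?_
  filter_upwards [ae_restrict_of_ae h.ae_forall_dyadic_ne,
    ae_restrict_mem measurableSet_Ici] with u hu hu0
  refine le_trans ?_ (lintegral_liminf_le fun n => (hm n).comp measurable_prodMk_left)
  rw [← lintegral_indicator₀ (h.nullMeasurableSet_passage he.measurable u)]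
  refine lintegral_mono_ae ?_
  filter_upwards [hu, h.start_zero, h.monotone_paths, h.right_continuous_paths]
    with ω h1 h2 h3 h4
  have := passageWeight_le_liminf e h3.1 h3.2 h4 (h2.2.le.trans hu0) h1 μ ρ c ν θ
  simpa only [mul_one] using this

lemma IsSubordinator.limsup_le_passageFunctional [IsProbabilityMeasure P]
    (h : IsSubordinator Z Y P) {q : ℝ} {e : Ω → ℝ≥0∞} (he : IsKillingTime e q Z Y P)
    (μ ρ c ν θ K : ℝ) :
    limsup (fun n =>
      (∑' k, ENNReal.ofReal (Real.exp (-(q * dyadic n (k + 1)))) *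
        truncMoment Z Y P ν μ K (dyadic n k)) *
        ∫⁻ x, crossingTotal ρ c θ x * cutoff K x ∂(marginal Z Y P (dyadic n 1))) atTop
      ≤ passageFunctional Z Y e P μ ρ c ν θ := by
  have hm := fun n => h.measurable_gridSum he.measurable ρ c θ
    (f := fun x => weight ν μ x * cutoff K x) (a := cutoff K) (by fun_prop) (by fun_prop) 1 n
  have hint := fun n => h.lintegral_gridSum he ρ c θ
    (f := fun x => weight ν μ x * cutoff K x) (a := cutoff K) (by fun_prop) (by fun_prop) 1 n
  simp_rw [truncMoment, ← hint]
  set C := ENNReal.ofReal (Real.exp ((|ρ| + |c| + |μ| + |ν| + |θ|) * (2 * K)))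
  have hbound : ∀ u ∈ Set.Ici (0 : ℝ), ∀ n, (fun ω => gridSum Z Y e ρ c θ
      (fun x => weight ν μ x * cutoff K x) (cutoff K) 1 n u ω) ≤ᵐ[P]
        fun _ => (Set.Icc 0 (2 * K)).indicator (fun _ => C) u := fun u hu n => by
    filter_upwards [h.start_zero, h.monotone_paths] with ω h2 h3
    exact gridSum_cutoff_le e h3.1 h3.2 h2.1.ge h2.2.ge (h2.2.le.trans hu) μ ρ c ν θ K n
  refine (limsup_lintegral_le ((Set.Icc 0 (2 * K)).indicator (fun _ => C))
    (fun n => (hm n).lintegral_prod_right') (fun n => ?_) ?_).trans ?_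
  · filter_upwards [ae_restrict_mem measurableSet_Ici] with u hu
    refine (lintegral_mono_ae (hbound u hu n)).trans ?_
    simp
  · refine ((setLIntegral_le_lintegral _ _).trans_lt ?_).ne
    rw [lintegral_indicator_const measurableSet_Icc, Real.volume_Icc]
    exact ENNReal.mul_lt_top ENNReal.ofReal_lt_top ENNReal.ofReal_lt_top
  refine lintegral_mono_ae ?_
  filter_upwards [ae_restrict_of_ae h.ae_forall_dyadic_ne,
    ae_restrict_mem measurableSet_Ici] with u hu hu0
  refine (limsup_lintegral_le (fun _ => (Set.Icc 0 (2 * K)).indicator (fun _ => C) u)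
    (fun n => (hm n).comp measurable_prodMk_left) (hbound u hu0) ?_).trans ?_
  · simp only [lintegral_const, measure_univ, mul_one]
    exact (lt_of_le_of_lt (Set.indicator_le_self _ (fun _ => C) u) ENNReal.ofReal_lt_top).ne
  rw [← lintegral_indicator₀ (h.nullMeasurableSet_passage he.measurable u)]
  refine lintegral_mono_ae ?_
  filter_upwards [hu, h.start_zero, h.monotone_paths, h.right_continuous_paths]
    with ω h1 h2 h3 h4
  exact limsup_le_passageWeight e h3.1 h3.2 h4 (h2.2.le.trans hu0) h1 μ ρ c ν θ K

/-- The passage functional decreases in the rate `c` charged to the undershoot, which is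
nonnegative. -/
lemma IsSubordinator.passageFunctional_anti [IsProbabilityMeasure P]
    (h : IsSubordinator Z Y P) {e : Ω → ℝ≥0∞} (he : Measurable e)
    (μ ρ ν θ : ℝ) {c c' : ℝ} (hcc : c ≤ c') :
    passageFunctional Z Y e P μ ρ c' ν θ ≤ passageFunctional Z Y e P μ ρ c ν θ := by
  refine lintegral_mono_ae ?_
  filter_upwards [ae_restrict_of_ae h.ae_forall_dyadic_ne,
    ae_restrict_mem measurableSet_Ici] with u hu hu0
  rw [← lintegral_indicator₀ (h.nullMeasurableSet_passage he u),
    ← lintegral_indicator₀ (h.nullMeasurableSet_passage he u)]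
  refine lintegral_mono_ae ?_
  filter_upwards [hu, h.start_zero, h.monotone_paths, h.right_continuous_paths]
    with ω h1 h2 h3 h4
  by_cases hT : passageTime Y u ω < e ω
  swap
  · rw [Set.indicator_of_notMem (by exact hT)]
    exact zero_le
  rw [Set.indicator_of_mem (by exact hT), Set.indicator_of_mem (by exact hT)]
  have hfin : ∃ s, u < Y s ω := by
    by_contra! hcon
    have : passageTime Y u ω = ⊤ := by simp [passageTime, fun s => not_lt.2 (hcon s)]
    exact not_top_lt (this ▸ hT)
  obtain ⟨k, hk, -, hlim, -⟩ := exists_bracket_tendsto h3.1 h3.2 h4 (h2.2.le.trans hu0) hfin h1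
  have hle : beforePassage Y Y u ω ≤ u := le_of_tendsto' hlim fun n => (hk n).1
  refine ENNReal.ofReal_le_ofReal (Real.exp_le_exp.2 ?_)
  have := mul_le_mul_of_nonneg_right hcc (sub_nonneg.2 hle)
  linarith

/-! ### Small-mesh asymptotics -/

lemma tendsto_coe_dyadic_one : Tendsto (fun n => (dyadic n 1 : ℝ)) atTop (𝓝[>] 0) :=
  tendsto_nhdsWithin_iff.2 ⟨NNReal.tendsto_coe.2 tendsto_dyadic_one,
    Eventually.of_forall fun n => by simp [coe_dyadic]⟩

lemma tendsto_one_sub_exp_div (x : ℝ) :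
    Tendsto (fun t : ℝ => (1 - Real.exp (-(x * t))) / t) (𝓝[>] 0) (𝓝 x) := by
  have hd : HasDerivAt (fun t : ℝ => 1 - Real.exp (-(x * t))) x 0 := by
    have := ((((hasDerivAt_id (0 : ℝ)).const_mul x).neg).exp).const_sub 1
    exact this.congr_deriv (by simp)
  have := (hasDerivAt_iff_tendsto_slope.1 hd).mono_left
    (nhdsWithin_mono _ fun t (ht : 0 < t) => ht.ne')
  refine this.congr fun t => ?_
  simp [slope_def_field]

lemma tendsto_exp_sub_div {α β κ : ℝ} (hκ : 0 < κ) :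
    Tendsto (fun t : ℝ => (Real.exp (-(β * t)) - Real.exp (-(α * t))) / (1 - Real.exp (-(κ * t))))
      (𝓝[>] 0) (𝓝 ((α - β) / κ)) := by
  have := ((tendsto_one_sub_exp_div α).sub (tendsto_one_sub_exp_div β)).div
    (tendsto_one_sub_exp_div κ) hκ.ne'
  refine this.congr' ?_
  filter_upwards [self_mem_nhdsWithin] with t ht
  have ht' : t ≠ 0 := ne_of_gt ht
  simp only [Pi.div_apply, ← sub_div]
  rw [div_div_div_cancel_right₀ ht']
  congr 1; ring

lemma exponent_eq_add (q a b : ℝ) : exponent Z Y q P a b = q + exponent Z Y 0 P a b := by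
  simp [exponent, sub_eq_add_neg]

lemma one_sub_exp_dyadic_pos {κ : ℝ} (hκ : 0 < κ) (n : ℕ) :
    0 < 1 - Real.exp (-(κ * dyadic n 1)) := by
  have : 0 < κ * (dyadic n 1 : ℝ) := by rw [coe_dyadic]; positivity
  have := Real.exp_lt_exp.2 (neg_lt_zero.2 this)
  rw [Real.exp_zero] at this
  linarith

/-- The sum over the steps is a geometric series of ratio `exp (-κ 2 ^ (-n))`. -/
lemma IsSubordinator.tsum_moment [IsProbabilityMeasure P]
    (h : IsSubordinator Z Y P) {q ν μ : ℝ} (hf : ExponentFinite Z Y P ν μ)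
    (hκ : 0 < exponent Z Y q P ν μ) (n : ℕ) :
    ∑' k, ENNReal.ofReal (Real.exp (-(q * dyadic n k))) * moment Z Y P ν μ (dyadic n k)
      = ENNReal.ofReal (1 - Real.exp (-(exponent Z Y q P ν μ * dyadic n 1)))⁻¹ := by
  have hterm : ∀ k, ENNReal.ofReal (Real.exp (-(q * dyadic n k))) * moment Z Y P ν μ (dyadic n k)
      = ENNReal.ofReal (Real.exp (-(exponent Z Y q P ν μ * dyadic n 1))) ^ k := fun k => by
    rw [h.moment_dyadic hf, ← ENNReal.ofReal_mul (Real.exp_pos _).le, ← Real.exp_add,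
      ← ENNReal.ofReal_pow (Real.exp_pos _).le, ← Real.exp_nat_mul, exponent_eq_add q,
      coe_dyadic, coe_dyadic]
    congr 2
    push_cast; ring
  simp_rw [hterm]
  rw [ENNReal.tsum_geometric, ENNReal.ofReal_inv_of_pos (one_sub_exp_dyadic_pos hκ n),
    ENNReal.ofReal_sub _ (Real.exp_pos _).le, ENNReal.ofReal_one]

/-- Lower bound by the steps which start before the time `M`: a partial sum of the geometric
series. -/
lemma le_tsum_truncMoment {q ν μ η K : ℝ} (hκ : 0 < exponent Z Y q P ν μ) {n M : ℕ}
    (hK : ∀ k, k ≤ M * 2 ^ n →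
      ENNReal.ofReal (Real.exp (-(exponent Z Y 0 P ν μ * dyadic n k) - η))
        ≤ truncMoment Z Y P ν μ K (dyadic n k)) :
    ENNReal.ofReal (Real.exp (-(q * dyadic n 1) - η) *
      ((1 - Real.exp (-(exponent Z Y q P ν μ * M))) /
        (1 - Real.exp (-(exponent Z Y q P ν μ * dyadic n 1))))) ≤
    ∑' k, ENNReal.ofReal (Real.exp (-(q * dyadic n (k + 1)))) *
        truncMoment Z Y P ν μ K (dyadic n k) := by
  set κ := exponent Z Y q P ν μ with hκdef
  set x := Real.exp (-(κ * dyadic n 1)) with hx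
  have hx1 := one_sub_exp_dyadic_pos hκ n
  have hxM : Real.exp (-(κ * M)) = x ^ (M * 2 ^ n) := by
    rw [hx, ← Real.exp_nat_mul, coe_dyadic]
    congr 1
    push_cast
    field_simp
  have hgeom : (1 - Real.exp (-(κ * M))) / (1 - x) = ∑ k ∈ Finset.range (M * 2 ^ n), x ^ k := by
    rw [hxM, geom_sum_eq (by linarith), ← neg_div_neg_eq, neg_sub, neg_sub]
  rw [hgeom, Finset.mul_sum, ENNReal.ofReal_sum_of_nonneg fun k _ => by positivity]
  refine le_trans (Finset.sum_le_sum fun k hk => ?_)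
    (ENNReal.sum_le_tsum (Finset.range (M * 2 ^ n)))
  refine le_trans (le_of_eq ?_) (mul_le_mul_right (hK k (Finset.mem_range.1 hk).le) _)
  rw [← ENNReal.ofReal_mul (Real.exp_pos _).le, hx, ← Real.exp_nat_mul, ← Real.exp_add,
    ← Real.exp_add, hκdef, exponent_eq_add q, coe_dyadic, coe_dyadic, coe_dyadic]
  congr 2
  push_cast; ring

/-! ### Evaluation of the passage functional -/

lemma IsSubordinator.lintegral_crossingTotal_eq [IsProbabilityMeasure P]
    (h : IsSubordinator Z Y P) {θ ρ c : ℝ} (hρc : ρ < c)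
    (hρ : ExponentFinite Z Y P θ ρ) (hc : ExponentFinite Z Y P θ c) (n : ℕ) :
    ∫⁻ x, crossingTotal ρ c θ x ∂(marginal Z Y P (dyadic n 1)) = ENNReal.ofReal
      ((Real.exp (-(exponent Z Y 0 P θ ρ * dyadic n 1))
        - Real.exp (-(exponent Z Y 0 P θ c * dyadic n 1))) / (c - ρ)) := by
  have hpos : 0 < c - ρ := sub_pos.2 hρc
  have hkey := h.lintegral_crossingTotal_full hρc θ (dyadic n 1)
  rw [h.moment_dyadic hρ, h.moment_dyadic hc] at hkey
  rw [ENNReal.ofReal_div_of_pos hpos, ENNReal.ofReal_sub _ (Real.exp_pos _).le, ← hkey,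
    ENNReal.add_sub_cancel_right ENNReal.ofReal_ne_top]
  exact (ENNReal.mul_div_cancel_right (by simpa using hpos) ENNReal.ofReal_ne_top).symm

/-- Only the subtracted transform may be replaced by the untruncated one; the other one is bounded
below through `β`, which is slightly larger than its exponent. -/
lemma IsSubordinator.le_lintegral_crossingTotal_cutoff [IsProbabilityMeasure P]
    (h : IsSubordinator Z Y P) {θ ρ c β K : ℝ} (hρc : ρ < c)
    (hc : ExponentFinite Z Y P θ c) {n : ℕ}
    (hK : ENNReal.ofReal (Real.exp (-(β * dyadic n 1))) ≤ truncMoment Z Y P θ ρ K (dyadic n 1)) :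
    ENNReal.ofReal ((Real.exp (-(β * dyadic n 1))
        - Real.exp (-(exponent Z Y 0 P θ c * dyadic n 1))) / (c - ρ)) ≤
      ∫⁻ x, crossingTotal ρ c θ x * cutoff K x ∂(marginal Z Y P (dyadic n 1)) := by
  have hpos : 0 < c - ρ := sub_pos.2 hρc
  have hkey := h.lintegral_crossingTotal hρc θ K (dyadic n 1)
  rw [ENNReal.ofReal_div_of_pos hpos, ENNReal.ofReal_sub _ (Real.exp_pos _).le]
  refine ENNReal.div_le_of_le_mul (tsub_le_iff_right.2 (hK.trans ?_))
  rw [← hkey, ← h.moment_dyadic hc]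
  gcongr
  exact truncMoment_le_moment ..

lemma IsSubordinator.exponent_le [IsProbabilityMeasure P]
    (h : IsSubordinator Z Y P) {θ ρ c : ℝ} (hρc : ρ < c)
    (hρ : ExponentFinite Z Y P θ ρ) (hc : ExponentFinite Z Y P θ c) :
    exponent Z Y 0 P θ ρ ≤ exponent Z Y 0 P θ c := by
  have h1 : moment Z Y P θ c 1 ≤ moment Z Y P θ ρ 1 := by
    rw [← h.lintegral_crossingTotal_full hρc θ 1]
    exact le_add_self
  rw [h.moment_one hρ, h.moment_one hc, ENNReal.ofReal_le_ofReal_iff (Real.exp_pos _).le,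
    Real.exp_le_exp] at h1
  linarith

/-- For distinct rates `ρ₁ < ρ₂` of the overshoot and the undershoot, in either order, the passage
functional is a difference quotient of the Laplace exponent. -/
lemma IsSubordinator.passageFunctional_eq [IsProbabilityMeasure P]
    (h : IsSubordinator Z Y P) {q : ℝ} {e : Ω → ℝ≥0∞} (he : IsKillingTime e q Z Y P)
    {μ ρ c ν θ ρ₁ ρ₂ : ℝ} (hlt : ρ₁ < ρ₂)
    (hsymm : ∀ x : ℝ × ℝ, 0 ≤ x.2 → crossingTotal ρ c θ x = crossingTotal ρ₁ ρ₂ θ x)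
    (h₁ : ExponentFinite Z Y P θ ρ₁) (h₂ : ExponentFinite Z Y P θ ρ₂)
    (hf : ExponentFinite Z Y P ν μ) (hκ : 0 < exponent Z Y q P ν μ) :
    passageFunctional Z Y e P μ ρ c ν θ = ENNReal.ofReal
      ((exponent Z Y 0 P θ ρ₂ - exponent Z Y 0 P θ ρ₁) / exponent Z Y q P ν μ / (ρ₂ - ρ₁)) := by
  set κ := exponent Z Y q P ν μ
  set κ₁ := exponent Z Y 0 P θ ρ₁
  set κ₂ := exponent Z Y 0 P θ ρ₂
  apply le_antisymm
  · refine (h.passageFunctional_le_liminf he μ ρ c ν θ).trans (le_of_eq ?_)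
    refine Tendsto.liminf_eq ?_
    have hlim := ENNReal.tendsto_ofReal
      (((tendsto_exp_sub_div (α := κ₂) (β := κ₁) hκ).comp tendsto_coe_dyadic_one).div_const
        (ρ₂ - ρ₁))
    refine hlim.congr fun n => ?_
    have hS : ∫⁻ x, crossingTotal ρ c θ x ∂(marginal Z Y P (dyadic n 1))
        = ∫⁻ x, crossingTotal ρ₁ ρ₂ θ x ∂(marginal Z Y P (dyadic n 1)) :=
      lintegral_congr_ae ((h.ae_marginal_nonneg _).mono hsymm)
    rw [hS, h.tsum_moment hf hκ, h.lintegral_crossingTotal_eq hlt h₁ h₂,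
      ← ENNReal.ofReal_mul (inv_nonneg.2 (one_sub_exp_dyadic_pos hκ n).le)]
    congr 1
    simp only [Function.comp_apply]
    ring
  · -- a lower bound for a fixed time horizon `M`, with a loss `1 / (M + 1)` for the truncation
    have hM : ∀ M : ℕ, ENNReal.ofReal ((Real.exp (-(1 / ((M : ℝ) + 1))) *
        (1 - Real.exp (-(κ * M)))) * ((κ₂ - (κ₁ + 1 / ((M : ℝ) + 1))) / κ / (ρ₂ - ρ₁)))
        ≤ passageFunctional Z Y e P μ ρ c ν θ := by
      intro M
      set η : ℝ := 1 / ((M : ℝ) + 1)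
      have hη : 0 < η := by positivity
      obtain ⟨K, hK1, hK2⟩ := ((h.eventually_le_truncMoment_dyadic hf hη M).and
        (h.eventually_le_truncMoment_dyadic_one h₁ (lt_add_of_pos_right κ₁ hη))).exists
      refine le_trans ?_ (h.limsup_le_passageFunctional he μ ρ c ν θ K)
      have hexp : Tendsto (fun t : ℝ => Real.exp (-(q * t) - η) * (1 - Real.exp (-(κ * M))))
          (𝓝[>] 0) (𝓝 (Real.exp (-η) * (1 - Real.exp (-(κ * M))))) := by
        have : Continuous fun t : ℝ => Real.exp (-(q * t) - η) * (1 - Real.exp (-(κ * M))) := by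
          fun_prop
        simpa using (this.tendsto 0).mono_left nhdsWithin_le_nhds
      have hlim := ENNReal.tendsto_ofReal
        ((hexp.comp tendsto_coe_dyadic_one).mul
          (((tendsto_exp_sub_div (α := κ₂) (β := κ₁ + η) hκ).comp tendsto_coe_dyadic_one).div_const
            (ρ₂ - ρ₁)))
      rw [← hlim.limsup_eq]
      refine limsup_le_limsup (Eventually.of_forall fun n => ?_)
      have hS : ∫⁻ x, crossingTotal ρ c θ x * cutoff K x ∂(marginal Z Y P (dyadic n 1))
          = ∫⁻ x, crossingTotal ρ₁ ρ₂ θ x * cutoff K x ∂(marginal Z Y P (dyadic n 1)) :=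
        lintegral_congr_ae ((h.ae_marginal_nonneg _).mono fun x hx => by
          simp only [hsymm x hx])
      dsimp only
      rw [hS]
      refine le_trans (le_of_eq ?_) (mul_le_mul' (le_tsum_truncMoment hκ fun k hk => hK1 n k hk)
        (h.le_lintegral_crossingTotal_cutoff hlt h₂ (hK2 n)))
      have hden := one_sub_exp_dyadic_pos hκ n
      have hnum : 0 ≤ 1 - Real.exp (-(κ * M)) := by
        have : -(κ * (M : ℝ)) ≤ 0 := by have := mul_nonneg hκ.le M.cast_nonneg; linarith
        linarith [Real.exp_le_one_iff.2 this]
      rw [← ENNReal.ofReal_mul (mul_nonneg (Real.exp_pos _).le (div_nonneg hnum hden.le))]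
      congr 1
      simp only [Function.comp_apply]
      ring
    have hη : Tendsto (fun M : ℕ => 1 / ((M : ℝ) + 1)) atTop (𝓝 0) :=
      tendsto_one_div_add_atTop_nhds_zero_nat
    have hκM : Tendsto (fun M : ℕ => Real.exp (-(κ * M))) atTop (𝓝 0) :=
      Real.tendsto_exp_neg_atTop_nhds_zero.comp
        (tendsto_natCast_atTop_atTop.const_mul_atTop hκ)
    have h1 : Tendsto (fun M : ℕ => Real.exp (-(1 / ((M : ℝ) + 1)))) atTop (𝓝 1) := by
      simpa [Function.comp_def] using (Real.continuous_exp.tendsto _).comp hη.neg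
    have hlim := (h1.mul (hκM.const_sub 1)).mul
      ((((hη.const_add κ₁).const_sub κ₂).div_const κ).div_const (ρ₂ - ρ₁))
    rw [sub_zero, one_mul, one_mul, add_zero] at hlim
    exact le_of_tendsto' (ENNReal.tendsto_ofReal hlim) hM

lemma IsSubordinator.exponentFinite_mono
    (h : IsSubordinator Z Y P) {θ ρ c : ℝ} (hρc : ρ ≤ c) (hρ : ExponentFinite Z Y P θ ρ) :
    ExponentFinite Z Y P θ c := by
  have hZ := h.measurable_fst 1
  have hY := h.measurable_snd 1
  refine Integrable.mono' hρ (by fun_prop) ?_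
  filter_upwards [h.ae_nonneg] with ω hω
  rw [Real.norm_of_nonneg (Real.exp_pos _).le]
  have := mul_le_mul_of_nonneg_right hρc (hω 1).2
  exact Real.exp_le_exp.2 (by linarith)

/-- The total crossing weight is lower semicontinuous in the second rate, by Fatou's lemma. -/
lemma crossingTotal_le_liminf {ρ c θ : ℝ} {γ : ℕ → ℝ} (hγ : Tendsto γ atTop (𝓝 c)) (x : ℝ × ℝ) :
    crossingTotal ρ c θ x ≤ liminf (fun m => crossingTotal ρ (γ m) θ x) atTop := by
  have hm : ∀ c, Measurable fun v => crossing ρ c θ v x := fun c =>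
    (measurable_crossing ρ c θ).comp measurable_prodMk_right
  refine le_trans (lintegral_mono fun v => ?_) (lintegral_liminf_le fun m => hm (γ m))
  have hlim : Tendsto (fun m => crossing ρ (γ m) θ v x) atTop (𝓝 (crossing ρ c θ v x)) := by
    unfold crossing
    by_cases hv : v ∈ Set.Ico 0 x.2
    · simp only [Set.indicator_of_mem hv]
      refine ENNReal.tendsto_ofReal ((Real.continuous_exp.tendsto _).comp ?_)
      exact ((hγ.mul_const v).const_sub _).sub_const _
    · simp only [Set.indicator_of_notMem hv]
      exact tendsto_const_nhds
  exact hlim.liminf_eq.ge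

lemma tendsto_slope_succ_inv {f : ℝ → ℝ} {D ρ : ℝ} (hD : HasDerivWithinAt f D (Set.Ioi ρ) ρ) :
    Tendsto (fun m : ℕ => (f (ρ + 1 / ((m : ℝ) + 1)) - f ρ) / (ρ + 1 / ((m : ℝ) + 1) - ρ)) atTop
      (𝓝 D) := by
  have hγ : Tendsto (fun m : ℕ => ρ + 1 / ((m : ℝ) + 1)) atTop (𝓝[>] ρ) := by
    refine tendsto_nhdsWithin_iff.2 ⟨?_, Eventually.of_forall fun m => ?_⟩
    · simpa using tendsto_one_div_add_atTop_nhds_zero_nat.const_add ρ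
    · exact lt_add_of_pos_right ρ (by positivity)
  have h1 := (hasDerivWithinAt_iff_tendsto_slope' (by simp)).1 hD
  refine (h1.comp hγ).congr fun m => ?_
  simp [slope_def_field]

/-- If the rates of the overshoot and the undershoot coincide, the difference quotient becomes a
right derivative. -/
lemma IsSubordinator.passageFunctional_self_eq [IsProbabilityMeasure P]
    (h : IsSubordinator Z Y P) {q : ℝ} {e : Ω → ℝ≥0∞} (he : IsKillingTime e q Z Y P)
    {μ ρ ν θ D : ℝ} (hρ : ExponentFinite Z Y P θ ρ)
    (hf : ExponentFinite Z Y P ν μ) (hκ : 0 < exponent Z Y q P ν μ)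
    (hD : HasDerivWithinAt (fun b => exponent Z Y 0 P θ b) D (Set.Ioi ρ) ρ) :
    passageFunctional Z Y e P μ ρ ρ ν θ = ENNReal.ofReal (D / exponent Z Y q P ν μ) := by
  set κ := exponent Z Y q P ν μ
  set κ₁ := exponent Z Y 0 P θ ρ with hκ₁
  set γ : ℕ → ℝ := fun m => ρ + 1 / ((m : ℝ) + 1) with hγ
  have hργ : ∀ m, ρ < γ m := fun m => lt_add_of_pos_right ρ (by positivity)
  have hγlim : Tendsto γ atTop (𝓝 ρ) := by
    simpa [hγ] using tendsto_one_div_add_atTop_nhds_zero_nat.const_add ρ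
  have hfin : ∀ m, ExponentFinite Z Y P θ (γ m) := fun m =>
    h.exponentFinite_mono (hργ m).le hρ
  apply le_antisymm
  · refine (h.passageFunctional_le_liminf he μ ρ ρ ν θ).trans ?_
    have hbound : ∀ n, ∫⁻ x, crossingTotal ρ ρ θ x ∂(marginal Z Y P (dyadic n 1))
        ≤ ENNReal.ofReal (dyadic n 1 * D * Real.exp (-(κ₁ * dyadic n 1))) := by
      intro n
      refine (lintegral_mono fun x => crossingTotal_le_liminf (ρ := ρ) (θ := θ) hγlim x).trans ?_
      refine (lintegral_liminf_le fun m => by fun_prop).trans (le_of_eq ?_)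
      refine Tendsto.liminf_eq ?_
      have hderiv : HasDerivWithinAt
          (fun b => -Real.exp (-(exponent Z Y 0 P θ b * dyadic n 1)))
          (dyadic n 1 * D * Real.exp (-(κ₁ * dyadic n 1))) (Set.Ioi ρ) ρ := by
        refine ((hD.mul_const (dyadic n 1 : ℝ)).neg.exp.neg).congr_deriv ?_
        simp only [hκ₁, Pi.neg_apply]
        ring
      refine (ENNReal.tendsto_ofReal (tendsto_slope_succ_inv hderiv)).congr fun m => ?_
      rw [h.lintegral_crossingTotal_eq (hργ m) hρ (hfin m)]
      congr 2
      ring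
    have hlim : Tendsto (fun t : ℝ => (1 - Real.exp (-(κ * t)))⁻¹ *
        (t * D * Real.exp (-(κ₁ * t)))) (𝓝[>] 0) (𝓝 (D / κ)) := by
      have hexp : Tendsto (fun t : ℝ => D * Real.exp (-(κ₁ * t))) (𝓝[>] 0) (𝓝 D) := by
        have : Continuous fun t : ℝ => D * Real.exp (-(κ₁ * t)) := by fun_prop
        simpa using (this.tendsto 0).mono_left nhdsWithin_le_nhds
      refine (hexp.div (tendsto_one_sub_exp_div κ) hκ.ne').congr fun t => ?_
      simp only [Pi.div_apply]
      rw [div_div_eq_mul_div, div_eq_inv_mul]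
      ring
    have hlim' := ENNReal.tendsto_ofReal (hlim.comp tendsto_coe_dyadic_one)
    rw [← hlim'.liminf_eq]
    refine liminf_le_liminf (Eventually.of_forall fun n => ?_)
    rw [h.tsum_moment hf hκ, Function.comp_apply,
      ENNReal.ofReal_mul (inv_nonneg.2 (one_sub_exp_dyadic_pos hκ n).le)]
    exact mul_le_mul_right (hbound n) _
  · have hlim := ENNReal.tendsto_ofReal ((tendsto_slope_succ_inv hD).div_const κ)
    refine le_of_tendsto' hlim fun m => ?_
    refine le_trans (le_of_eq ?_) (h.passageFunctional_anti he.measurable μ ρ ν θ (hργ m).le)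
    rw [h.passageFunctional_eq he (hργ m) (fun _ _ => rfl) hρ (hfin m) hf hκ]
    congr 1
    rw [div_right_comm]

end Functional

end BivariateSubordinator

open BivariateSubordinator in
theorem theorem4p5 {Ω : Type*} [MeasurableSpace Ω] (P : Measure Ω) [IsProbabilityMeasure P]
    (Z Y : ℝ≥0 → Ω → ℝ) (hZY : IsSubordinator Z Y P)
    (q : ℝ) (e : Ω → ℝ≥0∞) (he : IsKillingTime e q Z Y P)
    (μ ρ l ν θ : ℝ)
    (h₁ : ExponentFinite Z Y P θ (μ + l))
    (h₂ : ExponentFinite Z Y P θ ρ)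
    (h₃ : ExponentFinite Z Y P ν μ) (h₃' : 0 < exponent Z Y q P ν μ) :
    (l ≠ ρ - μ →
      0 ≤ (exponent Z Y q P θ (μ + l) - exponent Z Y q P θ ρ) /
          ((μ + l - ρ) * exponent Z Y q P ν μ) ∧
      ∫⁻ u in Set.Ici (0 : ℝ), ENNReal.ofReal (Real.exp (-μ * u)) *
          ∫⁻ ω in {ω | passageTime Y u ω < e ω},
            ENNReal.ofReal (Real.exp (-ρ * (atPassage Y Y u ω - u)
              - l * (u - beforePassage Y Y u ω)
              - ν * beforePassage Z Y u ω - θ * jumpAtPassage Z Y u ω)) ∂P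
        = ENNReal.ofReal ((exponent Z Y q P θ (μ + l) - exponent Z Y q P θ ρ) /
            ((μ + l - ρ) * exponent Z Y q P ν μ))) ∧
    (l = ρ - μ →
      ∀ D : ℝ, HasDerivWithinAt (fun b => exponent Z Y q P θ b) D (Set.Ioi ρ) ρ →
      0 ≤ 1 / exponent Z Y q P ν μ * D ∧
      ∫⁻ u in Set.Ici (0 : ℝ),
          ∫⁻ ω in {ω | passageTime Y u ω < e ω},
            ENNReal.ofReal (Real.exp (-ρ * jumpAtPassage Y Y u ω
              - μ * beforePassage Y Y u ω
              - ν * beforePassage Z Y u ω - θ * jumpAtPassage Z Y u ω)) ∂P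
        = ENNReal.ofReal (1 / exponent Z Y q P ν μ * D)) := by
  refine ⟨fun hl => ?_, fun hl D hD => ?_⟩
  · have hne : μ + l ≠ ρ := fun hcon => hl (by linarith)
    have hI : ∫⁻ u in Set.Ici (0 : ℝ), ENNReal.ofReal (Real.exp (-μ * u)) *
          ∫⁻ ω in {ω | passageTime Y u ω < e ω},
            ENNReal.ofReal (Real.exp (-ρ * (atPassage Y Y u ω - u)
              - l * (u - beforePassage Y Y u ω)
              - ν * beforePassage Z Y u ω - θ * jumpAtPassage Z Y u ω)) ∂P
        = passageFunctional Z Y e P μ ρ (μ + l) ν θ := by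
      refine lintegral_congr fun u => ?_
      rw [← lintegral_const_mul' _ _ ENNReal.ofReal_ne_top]
      refine lintegral_congr fun ω => ?_
      rw [passageWeight, ← ENNReal.ofReal_mul (Real.exp_pos _).le, ← Real.exp_add]
      congr 2
      ring
    have hq : exponent Z Y q P θ (μ + l) - exponent Z Y q P θ ρ
        = exponent Z Y 0 P θ (μ + l) - exponent Z Y 0 P θ ρ := by
      rw [exponent_eq_add q, exponent_eq_add q]; ring
    rw [hI, hq]
    rcases lt_or_gt_of_ne hne with hlt | hlt
    · have hle := hZY.exponent_le hlt h₁ h₂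
      rw [hZY.passageFunctional_eq he hlt (fun x hx => crossingTotal_comm _ _ _ hx) h₁ h₂ h₃ h₃']
      have heq : (exponent Z Y 0 P θ (μ + l) - exponent Z Y 0 P θ ρ) /
            ((μ + l - ρ) * exponent Z Y q P ν μ)
          = (exponent Z Y 0 P θ ρ - exponent Z Y 0 P θ (μ + l)) / exponent Z Y q P ν μ
            / (ρ - (μ + l)) := by
        rw [← neg_div_neg_eq, neg_sub, ← neg_mul, neg_sub, div_div, mul_comm]
      rw [heq]
      exact ⟨div_nonneg (div_nonneg (sub_nonneg.2 hle) h₃'.le) (sub_nonneg.2 hlt.le), rfl⟩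
    · have hle := hZY.exponent_le hlt h₂ h₁
      rw [hZY.passageFunctional_eq he hlt (fun _ _ => rfl) h₂ h₁ h₃ h₃', div_div,
        mul_comm (μ + l - ρ)]
      exact ⟨div_nonneg (sub_nonneg.2 hle) (mul_nonneg h₃'.le (sub_nonneg.2 hlt.le)), rfl⟩
  · have hD' : HasDerivWithinAt (fun b => exponent Z Y 0 P θ b) D (Set.Ioi ρ) ρ := by
      refine (hD.sub_const q).congr (fun b _ => ?_) ?_ <;>
      · rw [exponent_eq_add q]; ring
    have hI : ∫⁻ u in Set.Ici (0 : ℝ),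
          ∫⁻ ω in {ω | passageTime Y u ω < e ω},
            ENNReal.ofReal (Real.exp (-ρ * jumpAtPassage Y Y u ω
              - μ * beforePassage Y Y u ω
              - ν * beforePassage Z Y u ω - θ * jumpAtPassage Z Y u ω)) ∂P
        = passageFunctional Z Y e P μ ρ ρ ν θ := by
      refine lintegral_congr fun u => lintegral_congr fun ω => ?_
      rw [passageWeight]
      congr 2
      simp only [jumpAtPassage]
      ring
    have hD0 : 0 ≤ D := by
      refine ge_of_tendsto' (tendsto_slope_succ_inv hD') fun m => ?_
      have hlt : ρ < ρ + 1 / ((m : ℝ) + 1) := lt_add_of_pos_right ρ (by positivity)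
      exact div_nonneg (sub_nonneg.2 (hZY.exponent_le hlt h₂
        (hZY.exponentFinite_mono hlt.le h₂))) (sub_nonneg.2 hlt.le)
    refine ⟨by positivity, ?_⟩
    rw [hI, hZY.passageFunctional_self_eq he h₂ h₃ h₃' hD', one_div_mul_eq_div]
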